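/- Let $R$ be an integral domain which is either a local Gorenstein ring, or a standard graded Gorenstein $K$-algebra over a field $K=[R]_0$. All modules are finitely generated; in the graded case modules are ($\mathbb Z$-)graded, homomorphisms have degree zero, $a$ below is homogeneous and matrices are homogeneous. (In the local case ignore all degree shifts.) Write $\operatorname{codim} M=\dim R-\dim M$. A nonzero module is perfect if its projective dimension is finite and equals its grade $\min\{i:\operatorname{Ext}^i_R(M,R)\neq 0\}$. A module $C$ of codimension $c$ is quasi-Gorenstein if it is perfect and there is an isomorphism $\alpha:C\to\operatorname{Ext}^c_R(C,R)(s)$ for some integer $s$. For an epimorphism $\varphi:C\to M$ with $\dim M=\dim C$, let $L_C(\varphi)$ be the composition of $\alpha$ with the map $\operatorname{Ext}^c_R(C,R)(s)\to\operatorname{Ext}^c_R(\ker\varphi,R)(s)$ induced by the inclusion $\ker\varphi\subset C$. Modules $M,N$ are directly linked if there are a quasi-Gorenstein module $C$ and epimorphisms $\varphi:C\to M$, $\psi:C\to N$ with $\dim M=\dim N=\dim C$, $M\cong\operatorname{im}L_C(\psi)$ and $N\cong\operatorname{im}L_C(\varphi)$. The module liaison classes are the classes of the equivalence relation generated by direct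 linkage. **Theorem.** Let $a\in R$ be nonzero and not a unit. For an $R$-module $M$ the following are equivalent: 1. $M$ belongs to the module liaison class of $R/aR$; 2. $M$ is a perfect $R$-module of codimension one; 3. $M\neq 0$ and $M$ has a square presentation matrix with nonzero determinant, i.e. $M\cong\operatorname{coker}A$ for a (homogeneous) $A\in R^{n,n}$ with $\det A\neq 0$. -/

import Mathlib

open CategoryTheory

universe u v

/-! ## Gorenstein rings, perfect modules, codimension -/

/-- A commutative ring is Gorenstein if it is Noetherian and each of its localizations at a maximal
ideal has finite injective dimension as a module over itself. -/
class IsGorensteinRing (R : Type u) [CommRing R] : Prop extends IsNoetherianRing R where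
  injectiveDimension_ne_top : ∀ (m : Ideal R) [m.IsMaximal],
    injectiveDimension (ModuleCat.of (Localization.AtPrime m) (Localization.AtPrime m)) ≠ ⊤

section Modules

variable (R : Type u) [CommRing R] (M : Type u) [AddCommGroup M] [Module R M]

/-- The grade of a finitely generated `R`-module `M`: the least `i` with `Ext^i_R(M, R) ≠ 0`
(and `⊤` if there is none). -/
noncomputable def moduleGrade : ℕ∞ :=
  ⨅ (i : ℕ) (_ : Nontrivial (Abelian.Ext (ModuleCat.of R M) (ModuleCat.of R R) i)), (i : ℕ∞)

/-- A (finitely generated) module is perfect if it is nonzero, of finite projective dimension, and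
its projective dimension equals its grade. (The zero module has projective dimension `⊥`, so it is
not perfect. Over a local or a standard graded Gorenstein ring the perfect modules are the nonzero
Cohen-Macaulay modules of finite projective dimension.) -/
def IsPerfectModule : Prop :=
  ∃ g : ℕ, projectiveDimension (ModuleCat.of R M) = (g : WithBot ℕ∞) ∧ moduleGrade R M = (g : ℕ∞)

/-- `codim M = c`, where `codim M = dim R - dim M`. (The dimension of the zero module is `⊥`, so
over a nonzero ring it has no codimension in this sense.) -/
def HasCodim (c : ℕ) : Prop :=
  Module.supportDim R M + (c : WithBot ℕ∞) = ringKrullDim R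

end Modules

/-! ## Internal gradings through homogeneous components -/

section Components

variable {Γ : Type v} [DecidableEq Γ] {M : Type u} [AddCommGroup M]

/-- The component of degree `i` with respect to an internal direct sum decomposition. -/
noncomputable def grComp {gr : Γ → AddSubgroup M} (h : DirectSum.IsInternal gr) (i : Γ) : M →+ M :=
  letI := h.chooseDecomposition
  { toFun := fun x => (DirectSum.decompose gr x i : M)
    map_zero' := by simp
    map_add' := by intro x y; simp }

theorem grComp_mem {gr : Γ → AddSubgroup M} (h : DirectSum.IsInternal gr) (i : Γ) (x : M) :
    grComp h i x ∈ gr i :=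
  letI := h.chooseDecomposition
  (DirectSum.decompose gr x i).2

theorem grComp_same {gr : Γ → AddSubgroup M} (h : DirectSum.IsInternal gr) {i : Γ} {x : M}
    (hx : x ∈ gr i) : grComp h i x = x :=
  letI := h.chooseDecomposition
  DirectSum.decompose_of_mem_same gr hx

theorem grComp_ne {gr : Γ → AddSubgroup M} (h : DirectSum.IsInternal gr) {i j : Γ} {x : M}
    (hx : x ∈ gr i) (hij : i ≠ j) : grComp h j x = 0 :=
  letI := h.chooseDecomposition
  DirectSum.decompose_of_mem_ne gr hx hij

theorem exists_grComp_sum {gr : Γ → AddSubgroup M} (h : DirectSum.IsInternal gr) (x : M) :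
    ∃ s : Finset Γ, x = ∑ i ∈ s, grComp h i x := by
  classical
  let _ := h.chooseDecomposition
  exact ⟨(DirectSum.decompose gr x).support, (DirectSum.sum_support_decompose gr x).symm⟩

/-- A family of additive projections onto a family of subgroups makes it an internal direct sum. -/
theorem isInternal_of_proj (gr : Γ → AddSubgroup M) (p : Γ → M →+ M)
    (hsame : ∀ i x, x ∈ gr i → p i x = x) (hne : ∀ i j x, x ∈ gr i → i ≠ j → p j x = 0)
    (hmem : ∀ i x, p i x ∈ gr i) (hsum : ∀ x, ∃ s : Finset Γ, x = ∑ i ∈ s, p i x) :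
    DirectSum.IsInternal gr := by
  classical
  have key : ∀ (y : DirectSum Γ fun i => gr i) (j : Γ),
      p j (DirectSum.coeAddMonoidHom gr y) = (y j : M) := by
    intro y j
    induction y using DirectSum.induction_on with
    | zero => simp
    | of i x =>
      rw [DirectSum.coeAddMonoidHom_of]
      by_cases hij : i = j
      · subst hij
        rw [hsame i _ x.2, DirectSum.of_eq_same]
      · rw [hne i j _ x.2 hij, DirectSum.of_eq_of_ne _ _ _ (Ne.symm hij)]
        rfl
    | add x y hx hy => simp [hx, hy]
  constructor
  · intro y z hyz
    ext j
    rw [← key y j, ← key z j, hyz]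
  · intro x
    obtain ⟨s, hs⟩ := hsum x
    refine ⟨∑ i ∈ s, DirectSum.of (fun i => gr i) i ⟨p i x, hmem i x⟩, ?_⟩
    rw [map_sum]
    conv_rhs => rw [hs]
    exact Finset.sum_congr rfl fun i _ => DirectSum.coeAddMonoidHom_of _ _ _

end Components

/-! ## Finitely generated graded modules -/

section Graded

variable {Γ : Type v} [AddCommGroup Γ] [DecidableEq Γ] {R : Type u} [CommRing R]

/-- A finitely generated graded module over the `Γ`-graded ring `R = ⨁ 𝒜 i`. For `Γ = ℤ` these are
the usual graded modules; for the trivial group `Γ` they are just finitely generated modules. -/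
structure GrMod (𝒜 : Γ → AddSubgroup R) : Type (max (u + 1) v) where
  carrier : Type u
  [addCommGroup : AddCommGroup carrier]
  [module : Module R carrier]
  [finite : Module.Finite R carrier]
  gr : Γ → AddSubgroup carrier
  isInternal : DirectSum.IsInternal gr
  smul_mem : ∀ {i j : Γ} {r : R} {x : carrier}, r ∈ 𝒜 i → x ∈ gr j → r • x ∈ gr (i + j)

attribute [instance] GrMod.addCommGroup GrMod.module GrMod.finite

instance (𝒜 : Γ → AddSubgroup R) : CoeSort (GrMod 𝒜) (Type u) := ⟨GrMod.carrier⟩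

variable {𝒜 : Γ → AddSubgroup R}

/-- A homomorphism of graded modules (of degree zero). -/
structure GrHom (M N : GrMod 𝒜) where
  lin : M →ₗ[R] N
  map_mem : ∀ i x, x ∈ M.gr i → lin x ∈ N.gr i

/-- An isomorphism of graded modules (of degree zero). -/
structure GrIso (M N : GrMod 𝒜) where
  lin : M ≃ₗ[R] N
  map_mem_iff : ∀ i x, lin x ∈ N.gr i ↔ x ∈ M.gr i

theorem GrHom.grComp_map {M N : GrMod 𝒜} (f : GrHom M N) (i : Γ) (x : M) :
    grComp N.isInternal i (f.lin x) = f.lin (grComp M.isInternal i x) := by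
  classical
  obtain ⟨s, hs⟩ := exists_grComp_sum M.isInternal x
  have h1 : ∀ j, grComp N.isInternal i (f.lin (grComp M.isInternal j x)) =
      f.lin (grComp M.isInternal i (grComp M.isInternal j x)) := by
    intro j
    have hj := grComp_mem M.isInternal j x
    by_cases hij : j = i
    · subst hij
      rw [grComp_same _ (f.map_mem _ _ hj), grComp_same _ hj]
    · rw [grComp_ne _ (f.map_mem _ _ hj) hij, grComp_ne _ hj hij, map_zero]
  rw [hs]
  simp only [map_sum, h1]

namespace GrHom

/-- The composition of graded homomorphisms. -/
def comp {M N P : GrMod 𝒜} (g : GrHom N P) (f : GrHom M N) : GrHom M P where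
  lin := g.lin ∘ₗ f.lin
  map_mem i x hx := g.map_mem i _ (f.map_mem i x hx)

end GrHom

/-- The homomorphism underlying an isomorphism. -/
def GrIso.toHom {M N : GrMod 𝒜} (e : GrIso M N) : GrHom M N where
  lin := e.lin.toLinearMap
  map_mem i x hx := (e.map_mem_iff i x).2 hx

namespace GrMod

/-- A submodule of a graded module is graded if it contains the homogeneous components of each of
its elements. -/
def IsGradedSub (M : GrMod 𝒜) (N : Submodule R M) : Prop :=
  ∀ i x, x ∈ N → grComp M.isInternal i x ∈ N

theorem isGradedSub_ker {M N : GrMod 𝒜} (f : GrHom M N) : M.IsGradedSub (LinearMap.ker f.lin) := by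
  intro i x hx
  rw [LinearMap.mem_ker] at hx ⊢
  rw [← f.grComp_map, hx, map_zero]

theorem isGradedSub_range {M N : GrMod 𝒜} (f : GrHom M N) :
    N.IsGradedSub (LinearMap.range f.lin) := by
  rintro i _ ⟨x, rfl⟩
  exact ⟨_, (f.grComp_map i x).symm⟩

/-- The shifted module `M(j)`, with `[M(j)]_i = [M]_{i+j}`. -/
abbrev shift (M : GrMod 𝒜) (j : Γ) : GrMod 𝒜 where
  carrier := M
  gr i := M.gr (i + j)
  isInternal := by
    classical
    refine isInternal_of_proj _ (fun i => grComp M.isInternal (i + j)) ?_ ?_ ?_ ?_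
    · intro i x hx
      exact grComp_same _ hx
    · intro i k x hx hik
      exact grComp_ne _ hx fun h => hik (add_right_cancel h)
    · intro i x
      exact grComp_mem _ _ _
    · intro x
      obtain ⟨s, hs⟩ := exists_grComp_sum M.isInternal x
      refine ⟨s.map (Equiv.subRight j).toEmbedding, ?_⟩
      conv_lhs => rw [hs]
      simp
  smul_mem := by
    intro i k r x hr hx
    rw [add_assoc]
    exact M.smul_mem hr hx

/-- A graded submodule as a graded module. -/
abbrev sub [IsNoetherianRing R] (M : GrMod 𝒜) (N : Submodule R M) (hN : M.IsGradedSub N) :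
    GrMod 𝒜 where
  carrier := N
  gr i := (M.gr i).comap N.subtype.toAddMonoidHom
  isInternal := by
    refine isInternal_of_proj _
      (fun i => ((grComp M.isInternal i).comp N.subtype.toAddMonoidHom).codRestrict N
        fun x => hN i x x.2) ?_ ?_ ?_ ?_
    · intro i x hx
      exact Subtype.ext (grComp_same _ hx)
    · intro i k x hx hik
      exact Subtype.ext (grComp_ne M.isInternal hx hik)
    · intro i x
      exact grComp_mem M.isInternal i x
    · intro x
      obtain ⟨s, hs⟩ := exists_grComp_sum M.isInternal (x : M)
      refine ⟨s, Subtype.ext ?_⟩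
      rw [AddSubmonoidClass.coe_finsetSum]
      exact hs
  smul_mem := by
    intro i k r x hr hx
    exact M.smul_mem hr hx

/-- The quotient of a graded module by a graded submodule. -/
abbrev quot (M : GrMod 𝒜) (N : Submodule R M) (hN : M.IsGradedSub N) : GrMod 𝒜 where
  carrier := M ⧸ N
  gr i := (M.gr i).map N.mkQ.toAddMonoidHom
  isInternal := by
    have hp : ∀ i (x : M), QuotientAddGroup.map N.toAddSubgroup N.toAddSubgroup
        (grComp M.isInternal i) (fun y hy => hN i y hy) (N.mkQ x) =
        N.mkQ (grComp M.isInternal i x) := fun i x => rfl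
    refine isInternal_of_proj _ (fun i => QuotientAddGroup.map N.toAddSubgroup N.toAddSubgroup
        (grComp M.isInternal i) (fun y hy => hN i y hy)) ?_ ?_ ?_ ?_
    · rintro i _ ⟨x, hx, rfl⟩
      refine (hp i x).trans ?_
      rw [grComp_same _ hx]
      rfl
    · rintro i k _ ⟨x, hx, rfl⟩ hik
      refine (hp k x).trans ?_
      rw [grComp_ne _ hx hik, map_zero]
    · intro i x
      obtain ⟨x, rfl⟩ := N.mkQ_surjective x
      exact ⟨_, grComp_mem M.isInternal i x, (hp i x).symm⟩
    · intro x
      obtain ⟨x, rfl⟩ := N.mkQ_surjective x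
      obtain ⟨s, hs⟩ := exists_grComp_sum M.isInternal x
      refine ⟨s, ?_⟩
      conv_lhs => rw [hs, map_sum]
      exact Finset.sum_congr rfl fun i _ => (hp i x).symm
  smul_mem := by
    rintro i k r _ hr ⟨x, hx, rfl⟩
    exact ⟨r • x, M.smul_mem hr hx, map_smul N.mkQ r x⟩

/-- The kernel of a graded homomorphism. -/
abbrev ker [IsNoetherianRing R] {M N : GrMod 𝒜} (f : GrHom M N) : GrMod 𝒜 :=
  M.sub (LinearMap.ker f.lin) (isGradedSub_ker f)

/-- The inclusion of the kernel of a graded homomorphism. -/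
def kerIncl [IsNoetherianRing R] {M N : GrMod 𝒜} (f : GrHom M N) : GrHom (ker f) M where
  lin := (LinearMap.ker f.lin).subtype
  map_mem _ _ hx := hx

/-- The image of a graded homomorphism. -/
abbrev im [IsNoetherianRing R] {M N : GrMod 𝒜} (f : GrHom M N) : GrMod 𝒜 :=
  N.sub (LinearMap.range f.lin) (isGradedSub_range f)

end GrMod

/-! ## Graded free modules, homogeneous matrices -/

section Free

variable (𝒜) [GradedRing 𝒜]

theorem gradedRing_isInternal : DirectSum.IsInternal 𝒜 := DirectSum.Decomposition.isInternal 𝒜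

/-- The graded ring as a graded module over itself. -/
abbrev GrMod.self : GrMod 𝒜 where
  carrier := R
  gr := 𝒜
  isInternal := gradedRing_isInternal 𝒜
  smul_mem hr hx := SetLike.GradedMul.mul_mem hr hx

/-- The graded free module `⨁ R(-d_k)`, whose `k`-th basis vector has degree `d k`. -/
abbrev GrMod.free {n : ℕ} (d : Fin n → Γ) : GrMod 𝒜 where
  carrier := Fin n → R
  gr i :=
    { carrier := {v | ∀ k, v k ∈ 𝒜 (i - d k)}
      zero_mem' := fun k => (𝒜 (i - d k)).zero_mem
      add_mem' := fun hv hw k => (𝒜 (i - d k)).add_mem (hv k) (hw k)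
      neg_mem' := fun hv k => (𝒜 (i - d k)).neg_mem (hv k) }
  isInternal := by
    classical
    refine isInternal_of_proj _
      (fun i => AddMonoidHom.mk' (fun v k => grComp (gradedRing_isInternal 𝒜) (i - d k) (v k))
        (fun v w => by ext k; simp)) ?_ ?_ ?_ ?_
    · intro i v hv
      ext k
      exact grComp_same _ (hv k)
    · intro i j v hv hij
      ext k
      exact grComp_ne _ (hv k) fun h => hij (sub_left_injective h)
    · intro i v k
      exact grComp_mem _ _ _
    · intro v
      choose s hs using fun k => exists_grComp_sum (gradedRing_isInternal 𝒜) (v k)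
      have hz : ∀ k, ∀ j ∉ s k, grComp (gradedRing_isInternal 𝒜) j (v k) = 0 := by
        intro k j hj
        rw [hs k, map_sum]
        refine Finset.sum_eq_zero fun i hi => ?_
        exact grComp_ne _ (grComp_mem _ i _) fun h => hj (h ▸ hi)
      refine ⟨Finset.univ.biUnion fun k => (s k).map (Equiv.addRight (d k)).toEmbedding, ?_⟩
      ext k
      rw [Finset.sum_apply]
      have hsub : (s k).map (Equiv.addRight (d k)).toEmbedding ⊆
          Finset.univ.biUnion fun k => (s k).map (Equiv.addRight (d k)).toEmbedding :=
        Finset.subset_biUnion_of_mem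
          (fun k => (s k).map (Equiv.addRight (d k)).toEmbedding) (Finset.mem_univ k)
      rw [← Finset.sum_subset hsub]
      · conv_lhs => rw [hs k]
        simp
      · intro j _ hj
        refine hz k _ fun h => hj ?_
        rw [Finset.mem_map]
        exact ⟨_, h, by simp⟩
  smul_mem := by
    intro i j r v hr hv k
    rw [add_sub_assoc]
    exact SetLike.GradedMul.mul_mem hr (hv k)

/-- An `m × n` matrix is homogeneous with respect to row degrees `d` and column degrees `e` if it
represents a graded homomorphism `⨁ R(-e_k) → ⨁ R(-d_j)`. -/
def IsHomogeneousMatrix {m n : ℕ} (d : Fin m → Γ) (e : Fin n → Γ)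
    (A : Matrix (Fin m) (Fin n) R) : Prop :=
  ∀ j k, A j k ∈ 𝒜 (e k - d j)

variable {𝒜}

/-- The graded homomorphism `v ↦ A v` represented by a homogeneous matrix. -/
def matrixHom {m n : ℕ} {d : Fin m → Γ} {e : Fin n → Γ} (A : Matrix (Fin m) (Fin n) R)
    (hA : IsHomogeneousMatrix 𝒜 d e A) : GrHom (GrMod.free 𝒜 e) (GrMod.free 𝒜 d) where
  lin := A.mulVecLin
  map_mem := by
    intro i v hv j
    change ∑ k, A j k * v k ∈ _
    refine AddSubgroup.sum_mem _ fun k _ => ?_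
    have h := SetLike.GradedMul.mul_mem (hA j k) (hv k)
    have he : e k - d j + (i - e k) = i - d j := by abel
    rwa [he] at h

/-- The transpose represents the dual homomorphism `⨁ R(d_j) → ⨁ R(e_k)`. -/
theorem isHomogeneousMatrix_transpose {m n : ℕ} {d : Fin m → Γ} {e : Fin n → Γ}
    {A : Matrix (Fin m) (Fin n) R} (hA : IsHomogeneousMatrix 𝒜 d e A) :
    IsHomogeneousMatrix 𝒜 (-e) (-d) A.transpose := by
  intro k j
  have he : (-d) j - (-e) k = e k - d j := by simp only [Pi.neg_apply]; abel
  rw [he]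
  exact hA j k

/-! ## Graded free resolutions and graded Ext -/

/-- A graded free resolution `⋯ → F_2 → F_1 → F_0 → M → 0` of a graded module by finitely generated
graded free modules `F_i = ⨁ R(-deg i k)`, the maps being given by homogeneous matrices. -/
structure FreeRes (M : GrMod 𝒜) where
  rank : ℕ → ℕ
  deg : (i : ℕ) → Fin (rank i) → Γ
  mat : (i : ℕ) → Matrix (Fin (rank i)) (Fin (rank (i + 1))) R
  homogeneous : ∀ i, IsHomogeneousMatrix 𝒜 (deg i) (deg (i + 1)) (mat i)
  aug : GrHom (GrMod.free 𝒜 (deg 0)) M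
  surjective : Function.Surjective aug.lin
  exact_zero : Function.Exact (mat 0).mulVecLin aug.lin
  exact_succ : ∀ i, Function.Exact (mat (i + 1)).mulVecLin (mat i).mulVecLin

namespace FreeRes

/-- The term `F_c^* = Hom_R(F_c, R) = ⨁ R(deg c k)` of the dual complex. -/
abbrev dualTerm {M : GrMod 𝒜} (P : FreeRes M) (c : ℕ) : GrMod 𝒜 := GrMod.free 𝒜 (-P.deg c)

/-- The differential `F_c^* → F_{c+1}^*` of the dual complex. -/
def dualMap {M : GrMod 𝒜} (P : FreeRes M) (c : ℕ) : GrHom (P.dualTerm c) (P.dualTerm (c + 1)) :=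
  matrixHom (P.mat c).transpose (isHomogeneousMatrix_transpose (P.homogeneous c))

/-- The image of the differential `F_{c-1}^* → F_c^*` (zero for `c = 0`). -/
def coboundaries {M : GrMod 𝒜} (P : FreeRes M) : (c : ℕ) → Submodule R (P.dualTerm c)
  | 0 => ⊥
  | c + 1 => LinearMap.range (P.dualMap c).lin

theorem isGradedSub_coboundaries {M : GrMod 𝒜} (P : FreeRes M) (c : ℕ) :
    (P.dualTerm c).IsGradedSub (P.coboundaries c) := by
  cases c with
  | zero =>
    intro i x hx
    have hx : x = 0 := hx
    rw [hx, map_zero]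
    exact Submodule.zero_mem _
  | succ c => exact GrMod.isGradedSub_range (P.dualMap c)

variable [IsNoetherianRing R]

/-- The coboundaries among the cocycles form a graded submodule. -/
theorem isGradedSub_comap {M : GrMod 𝒜} (P : FreeRes M) (c : ℕ) :
    (GrMod.ker (P.dualMap c)).IsGradedSub
      ((P.coboundaries c).comap (GrMod.kerIncl (P.dualMap c)).lin) := by
  intro i x hx
  have h := P.isGradedSub_coboundaries c i _ hx
  rwa [(GrMod.kerIncl (P.dualMap c)).grComp_map i x] at h

/-- The graded module `Ext^c_R(M, R)`, computed as the cohomology at `F_c^*` of the complex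
`Hom_R(F, R)`. -/
abbrev ext {M : GrMod 𝒜} (P : FreeRes M) (c : ℕ) : GrMod 𝒜 :=
  (GrMod.ker (P.dualMap c)).quot
    ((P.coboundaries c).comap (GrMod.kerIncl (P.dualMap c)).lin) (P.isGradedSub_comap c)

end FreeRes

/-- A chain map `P → Q` between graded free resolutions lifting the graded homomorphism
`f : M → N`, given by homogeneous matrices. -/
structure ResLift {M N : GrMod 𝒜} (P : FreeRes M) (Q : FreeRes N) (f : GrHom M N) where
  mat : (i : ℕ) → Matrix (Fin (Q.rank i)) (Fin (P.rank i)) R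
  homogeneous : ∀ i, IsHomogeneousMatrix 𝒜 (Q.deg i) (P.deg i) (mat i)
  comm_aug : ∀ v, Q.aug.lin ((mat 0).mulVec v) = f.lin (P.aug.lin v)
  comm : ∀ i, Q.mat i * mat (i + 1) = mat i * P.mat i

namespace ResLift

variable {M N : GrMod 𝒜} {P : FreeRes M} {Q : FreeRes N} {f : GrHom M N}

/-- The map `Hom_R(Q_c, R) → Hom_R(P_c, R)` induced by a chain map. -/
def dualMap (B : ResLift P Q f) (c : ℕ) : GrHom (Q.dualTerm c) (P.dualTerm c) :=
  matrixHom (B.mat c).transpose (isHomogeneousMatrix_transpose (B.homogeneous c))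

theorem dualMap_comm (B : ResLift P Q f) (c : ℕ) (x : Q.dualTerm c) :
    (P.dualMap c).lin ((B.dualMap c).lin x) = (B.dualMap (c + 1)).lin ((Q.dualMap c).lin x) := by
  have h : ∀ y : Fin (Q.rank c) → R,
      (P.mat c).transpose.mulVec ((B.mat c).transpose.mulVec y) =
        (B.mat (c + 1)).transpose.mulVec ((Q.mat c).transpose.mulVec y) := by
    intro y
    rw [Matrix.mulVec_mulVec, Matrix.mulVec_mulVec, ← Matrix.transpose_mul,
      ← Matrix.transpose_mul, B.comm]
  exact h x

theorem dualMap_mem_ker (B : ResLift P Q f) (c : ℕ) (x : Q.dualTerm c)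
    (hx : x ∈ LinearMap.ker (Q.dualMap c).lin) :
    (B.dualMap c).lin x ∈ LinearMap.ker (P.dualMap c).lin := by
  rw [LinearMap.mem_ker] at hx ⊢
  rw [B.dualMap_comm, hx, map_zero]

theorem dualMap_mem_coboundaries (B : ResLift P Q f) (c : ℕ) (x : Q.dualTerm c)
    (hx : x ∈ Q.coboundaries c) : (B.dualMap c).lin x ∈ P.coboundaries c := by
  cases c with
  | zero =>
    have hx : x = 0 := hx
    rw [hx, map_zero]
    exact Submodule.zero_mem _
  | succ c =>
    obtain ⟨y, rfl⟩ := hx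
    exact ⟨(B.dualMap c).lin y, B.dualMap_comm c y⟩

variable [IsNoetherianRing R]

/-- The map on cocycles induced by a chain map. -/
def cocycleMap (B : ResLift P Q f) (c : ℕ) :
    GrHom (GrMod.ker (Q.dualMap c)) (GrMod.ker (P.dualMap c)) where
  lin := (B.dualMap c).lin.restrict (B.dualMap_mem_ker c)
  map_mem i x hx := (B.dualMap c).map_mem i x.1 hx

/-- The graded homomorphism `Ext^c_R(N, R) → Ext^c_R(M, R)` induced by `f : M → N`. -/
def extMap (B : ResLift P Q f) (c : ℕ) : GrHom (Q.ext c) (P.ext c) where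
  lin := Submodule.mapQ _ _ (B.cocycleMap c).lin
    fun x hx => B.dualMap_mem_coboundaries c x.1 hx
  map_mem := by
    rintro i _ ⟨x, hx, rfl⟩
    exact ⟨(B.cocycleMap c).lin x, (B.cocycleMap c).map_mem i x hx, rfl⟩

end ResLift

/-- A graded homomorphism, regarded as a homomorphism between the shifted modules. -/
def GrHom.shift {M N : GrMod 𝒜} (f : GrHom M N) (j : Γ) : GrHom (M.shift j) (N.shift j) where
  lin := f.lin
  map_mem i x hx := f.map_mem (i + j) x hx

/-! ## Module liaison -/

variable [IsNoetherianRing R]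

/-- `C` is a quasi-Gorenstein module of codimension `c` via the isomorphism
`α : C ≅ Ext^c_R(C, R)(s)`, where the Ext module is computed from the free resolution `res`.
(The canonical module of `C` is `Ext^c_R(C, R)` up to a shift.) -/
structure QuasiGorenstein (C : GrMod 𝒜) where
  isPerfect : IsPerfectModule R C
  c : ℕ
  hasCodim : HasCodim R C c
  res : FreeRes C
  s : Γ
  α : GrIso C ((res.ext c).shift s)

/-- The homomorphism `L_C(φ) : C → Ext^c_R(ker φ, R)(s)`: the composition of `α` with the map
`Ext^c_R(C, R)(s) → Ext^c_R(ker φ, R)(s)` induced by the inclusion `ker φ → C`. Here `P` is the free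
resolution of `ker φ` used to compute Ext, and `B` is a chain map lifting the inclusion. -/
def linkHom {C M : GrMod 𝒜} (q : QuasiGorenstein C) (φ : GrHom C M) (P : FreeRes (GrMod.ker φ))
    (B : ResLift P q.res (GrMod.kerIncl φ)) : GrHom C ((P.ext q.c).shift q.s) :=
  ((B.extMap q.c).shift q.s).comp q.α.toHom

/-- `N ≅ im L_C(φ)`. (Up to isomorphism the image does not depend on the resolution `P` and the
lifting `B`, which exist because `R` is Noetherian.) -/
def IsLinkImage {C M : GrMod 𝒜} (q : QuasiGorenstein C) (φ : GrHom C M) (N : GrMod 𝒜) : Prop :=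
  ∃ (P : FreeRes (GrMod.ker φ)) (B : ResLift P q.res (GrMod.kerIncl φ)),
    Nonempty (GrIso N (GrMod.im (linkHom q φ P B)))

/-- `φ ∈ Epi(C)` with image `M`: a graded epimorphism `C → M` where `dim M = dim C`. -/
def IsEpiOnto {C M : GrMod 𝒜} (φ : GrHom C M) : Prop :=
  Function.Surjective φ.lin ∧ Module.supportDim R M = Module.supportDim R C

/-- `M` and `N` are module linked in one step (by some quasi-Gorenstein module `C`). -/
def DirectlyLinked (M N : GrMod 𝒜) : Prop :=
  ∃ (C : GrMod 𝒜) (q : QuasiGorenstein C) (φ : GrHom C M) (ψ : GrHom C N),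
    IsEpiOnto φ ∧ IsEpiOnto ψ ∧ IsLinkImage q ψ M ∧ IsLinkImage q φ N

/-- Module liaison: the equivalence relation generated by direct module linkage. -/
def SameLiaisonClass (M N : GrMod 𝒜) : Prop := Relation.EqvGen DirectlyLinked M N

/-- `M` has a square presentation matrix with nonzero determinant: it is isomorphic to the cokernel
of a homogeneous matrix `A : ⨁ R(-e_k) → ⨁ R(-d_j)` with `det A ≠ 0`. -/
def HasSquarePresentation (M : GrMod 𝒜) : Prop :=
  ∃ (n : ℕ) (d e : Fin n → Γ) (A : Matrix (Fin n) (Fin n) R) (π : GrHom (GrMod.free 𝒜 d) M),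
    IsHomogeneousMatrix 𝒜 d e A ∧ A.det ≠ 0 ∧
      Function.Surjective π.lin ∧ Function.Exact A.mulVecLin π.lin

/-- Multiplication by a homogeneous element `a` of degree `δ`, as a graded homomorphism
`R(-δ) → R`. -/
def mulHom {δ : Γ} {a : R} (ha : a ∈ 𝒜 δ) :
    GrHom ((GrMod.self 𝒜).shift (-δ)) (GrMod.self 𝒜) where
  lin := (LinearMap.mulRight R a : R →ₗ[R] R)
  map_mem := by
    intro i (x : R) (hx : x ∈ 𝒜 (i + -δ))
    have h : x * a ∈ 𝒜 (i + -δ + δ) := SetLike.GradedMul.mul_mem hx ha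
    rwa [neg_add_cancel_right] at h

/-- The graded module `R/aR`, where `a` is homogeneous. -/
abbrev GrMod.modPrincipal {δ : Γ} {a : R} (ha : a ∈ 𝒜 δ) : GrMod 𝒜 :=
  (GrMod.self 𝒜).quot (LinearMap.range (mulHom ha).lin) (GrMod.isGradedSub_range (mulHom ha))

end Free

/-- A `ℤ`-graded ring `R = ⨁ [R]_i` is a standard graded algebra over the field `K` if `[R]_i = 0`
for `i < 0`, `[R]_0 = K`, and `R` is generated by `[R]_1` as a `K`-algebra. (Finite generation is
automatic if `R` is Noetherian.) -/
structure IsStandardGraded (K : Type*) [Field K] [Algebra K R] (𝒜 : ℤ → AddSubgroup R) : Prop where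
  eq_bot_of_neg : ∀ i < 0, 𝒜 i = ⊥
  zero_eq : (𝒜 0 : Set R) = Set.range (algebraMap K R)
  adjoin_one : Algebra.adjoin K (𝒜 1 : Set R) = ⊤

end Graded

/-! ## Ungraded modules, as modules graded by the trivial group -/

section Ungraded

variable (R : Type u) [CommRing R]

/-- The grading of a ring by the trivial group. -/
def trivialGrading : Unit → AddSubgroup R := fun _ => ⊤

theorem isInternal_top (M : Type u) [AddCommGroup M] :
    DirectSum.IsInternal (fun _ : Unit => (⊤ : AddSubgroup M)) :=
  isInternal_of_proj _ (fun _ => AddMonoidHom.id M) (fun _ _ _ => rfl)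
    (fun _ _ _ _ h => (h rfl).elim) (fun _ _ => trivial) (fun x => ⟨{()}, by simp⟩)

noncomputable instance : GradedRing (trivialGrading R) :=
  { (isInternal_top R).chooseDecomposition with
    one_mem := trivial
    mul_mem := fun _ _ _ _ _ _ => trivial }

/-- A finitely generated module over an ungraded ring, as a module graded by the trivial group. -/
abbrev GrMod.ofModule (M : Type u) [AddCommGroup M] [Module R M] [Module.Finite R M] :
    GrMod (trivialGrading R) where
  carrier := M
  gr _ := ⊤
  isInternal := isInternal_top M
  smul_mem _ _ := trivial

end Ungraded

/-!
# The module liaison class of a hypersurface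

Let `m` be the maximal ideal of the local ring `R`, or the irrelevant ideal of the standard graded
algebra `R`. Both are instances of `IsGradedLocal`: the height of `m` is `dim R`, and homogeneous
elements outside `m` are units. The ungraded case is graded by the trivial group, so that both cases
have the same proof.

*Perfect modules of codimension one are cokernels of square matrices.* A module `M` of codimension
one has grade one, so it is perfect if and only if its projective dimension is at most one
(`isPerfectModule_iff`). In that case the first syzygy module of `M` is projective, hence graded
free (`GrMod.exists_basis_of_projective`), of full rank since `M` is torsion. Conversely, a matrix
`A` with nonzero determinant is injective, and `coker A` is supported on the hypersurface
`det A = 0`.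

*Liaison preserves perfection in codimension one.* Let `N` be linked to `M` by `C`, via the
epimorphism `φ : C → M`. If `M` has projective dimension at most one, then `Ext^2(M, R) = 0`, so
that `L_C(φ)` is surjective and `N` is isomorphic to `Ext^1(ker φ, R)`. The kernel of `φ` has
projective dimension at most one, and so has its Ext module
(`IsLinkImage.hasProjectiveDimensionLE`).

*The nonzero cokernels of square matrices with nonzero determinant are in one liaison class.* If
`A * B` is symmetric, then `C = coker (A * B)` is quasi-Gorenstein, since dualizing its resolution
transposes the matrix. The kernel of `C → coker A` is `coker B`, so `C` links `coker A` to `coker Bᵀ`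
(`directlyLinked_of_mul_symmetric`). For symmetric `S` the choice `B = S * Aᵀ` links `coker A` to
`coker (A * S)`. Applied to the bordered matrix `[[A, 0], [0, 1]]`, which has the same cokernel as
`A`, and to a suitable `S`, this shows that replacing the `j`-th column of `A` by `A v`, where
`v j ≠ 0`, gives a linked module (`directlyLinked_updateCol`). After bordering, the matrices `A` of
`M` and `B` of `R/aR` have the same size and row degrees. As in the Steinitz exchange lemma, the
columns of `A` can be replaced one by one by nonzero multiples of those of `B`
(`exists_sameLiaisonClass_columns`), and multiplying a column of `B` by a nonzero element is a
column replacement as well (`sameLiaisonClass_mul_diagonal`).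
-/

/-! ### Perfect modules of codimension one -/

section Perfect

variable {R : Type u} [CommRing R] (M : Type u) [AddCommGroup M] [Module R M]

theorem ringKrullDim_ne_bot_of_nontrivial (R : Type u) [CommRing R] [Nontrivial R] :
    ringKrullDim R ≠ ⊥ := by
  intro h
  have := ringKrullDim_nonneg_of_nontrivial (R := R)
  rw [h] at this
  simp at this

theorem nontrivial_of_hasCodim [Nontrivial R] {c : ℕ} (h : HasCodim R M c) :
    Nontrivial M := by
  by_contra hM
  rw [not_nontrivial_iff_subsingleton] at hM
  rw [HasCodim, Module.supportDim_eq_bot_of_subsingleton, WithBot.bot_add] at h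
  exact ringKrullDim_ne_bot_of_nontrivial R h.symm

/-- Numbers `c` with `dim M + c = d` are determined by `d` as soon as `d` is finite. -/
theorem natCast_eq_of_add_eq {x d : WithBot ℕ∞} {a b : ℕ} (hd : d ≠ ⊤) (hb : d ≠ ⊥)
    (h1 : x + (a : WithBot ℕ∞) = d) (h2 : x + (b : WithBot ℕ∞) = d) : a = b := by
  induction x with
  | bot => simp at h1; exact absurd h1.symm hb
  | coe x =>
    induction x with
    | top =>
      exfalso
      apply hd
      rw [← h1]
      have : ((⊤ : ℕ∞) + (a : ℕ∞) : ℕ∞) = ⊤ := top_add _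
      exact_mod_cast congrArg (WithBot.some) this
    | coe x =>
      have : (x : WithBot ℕ∞) + (a : WithBot ℕ∞) = (x : WithBot ℕ∞) + (b : WithBot ℕ∞) := by
        exact h1.trans h2.symm
      have h3 : x + a = x + b := by exact_mod_cast this
      omega

/-- Two elements of the annihilator forming a regular sequence force codimension at least two. -/
theorem supportDim_add_two_le [IsNoetherianRing R] [Module.Finite R M] {x y : R}
    (hx : x ∈ Module.annihilator R M) (hy : y ∈ Module.annihilator R M)
    (hxr : IsSMulRegular R x) (hyr : IsSMulRegular (QuotSMulTop x R) y) :
    Module.supportDim R M + 1 + 1 ≤ ringKrullDim R := by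
  have h1 : Module.supportDim R (QuotSMulTop x R) + 1 ≤ ringKrullDim R := by
    rw [← Module.supportDim_self_eq_ringKrullDim]
    exact Module.supportDim_quotSMulTop_succ_le_of_notMem_minimalPrimes
      fun _ => hxr.notMem_of_mem_minimalPrimes
  have h2 : Module.supportDim R (QuotSMulTop y (QuotSMulTop x R)) + 1 ≤
      Module.supportDim R (QuotSMulTop x R) :=
    Module.supportDim_quotSMulTop_succ_le_of_notMem_minimalPrimes
      fun _ => hyr.notMem_of_mem_minimalPrimes
  have h3 : Module.supportDim R M ≤ Module.supportDim R (QuotSMulTop y (QuotSMulTop x R)) := by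
    refine Order.krullDim_le_of_strictMono (Set.inclusion fun p hp => ?_) fun p q hpq => hpq
    · have hp : Module.annihilator R M ≤ p.asIdeal := Module.mem_support_iff_of_finite.1 hp
      rw [Module.support_quotSMulTop, Module.support_quotSMulTop]
      refine ⟨⟨?_, ?_⟩, ?_⟩
      · rw [Module.mem_support_iff_of_finite]
        intro r hr
        have h0 : r * 1 = 0 := Module.mem_annihilator.1 hr 1
        rw [mul_one] at h0
        exact h0 ▸ zero_mem _
      · simpa using hp hx
      · simpa using hp hy
  calc Module.supportDim R M + 1 + 1 ≤ Module.supportDim R (QuotSMulTop x R) + 1 := by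
        gcongr; exact le_trans (by gcongr) h2
    _ ≤ _ := h1

variable [IsDomain R]

/-- A module of codimension one over a domain of finite dimension is torsion. -/
theorem exists_annihilator_ne_zero [Module.Finite R M] (hd : ringKrullDim R ≠ ⊤)
    (h : HasCodim R M 1) : ∃ a ∈ Module.annihilator R M, a ≠ 0 := by
  by_contra! H
  have h0 : Module.annihilator R M = ⊥ := by
    rw [eq_bot_iff]; intro x hx; simpa using H x hx
  have h1 : Module.supportDim R M = ringKrullDim R := by
    rw [Module.supportDim_eq_ringKrullDim_quotient_annihilator, h0]
    exact ringKrullDim_eq_of_ringEquiv (RingEquiv.quotientBot R)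
  have h2 : Module.supportDim R M + ((0 : ℕ) : WithBot ℕ∞) = ringKrullDim R := by simp [h1]
  exact absurd (natCast_eq_of_add_eq hd (ringKrullDim_ne_bot_of_nontrivial R) h h2) one_ne_zero

variable {M} in
theorem linearMap_eq_zero_of_annihilator {F : Type*} [AddCommGroup F] [Module R F]
    [Module.IsTorsionFree R F]
    {a : R} (ha : a ∈ Module.annihilator R M) (ha0 : a ≠ 0) (f : M →ₗ[R] F) : f = 0 := by
  ext x
  have : a • f x = 0 := by rw [← map_smul, Module.mem_annihilator.1 ha, map_zero]
  simpa [ha0] using this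

theorem subsingleton_ext_zero {a : R} (ha : a ∈ Module.annihilator R M) (ha0 : a ≠ 0) :
    Subsingleton (Abelian.Ext (ModuleCat.of R M) (ModuleCat.of R R) 0) := by
  have : Subsingleton (ModuleCat.of R M ⟶ ModuleCat.of R R) := by
    refine ⟨fun f g => ?_⟩
    ext1
    rw [linearMap_eq_zero_of_annihilator ha ha0 f.hom,
      linearMap_eq_zero_of_annihilator ha ha0 g.hom]
  exact Abelian.Ext.homEquiv₀.subsingleton

/-- A module of codimension one has grade one: it is torsion, so it has no nonzero homomorphisms to
`R`, and if `Ext^1(M, R)` vanished as well, the annihilator of `M` would contain a regular sequence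
of length two. -/
theorem moduleGrade_eq_one [IsNoetherianRing R] [Module.Finite R M] (hd : ringKrullDim R ≠ ⊤)
    (h : HasCodim R M 1) : moduleGrade R M = 1 := by
  obtain ⟨a, ha, ha0⟩ := exists_annihilator_ne_zero M hd h
  have h0 := subsingleton_ext_zero M ha ha0
  have hnt := nontrivial_of_hasCodim M h
  have h1 : Nontrivial (Abelian.Ext (ModuleCat.of R M) (ModuleCat.of R R) 1) := by
    by_contra hn
    rw [not_nontrivial_iff_subsingleton] at hn
    have hann : Module.annihilator R M ≠ ⊤ := by
      rw [Ne, Module.annihilator_eq_top_iff, not_subsingleton_iff_nontrivial]; exact hnt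
    obtain ⟨rs, hl, hrs, hreg⟩ := ModuleCat.exists_isRegular_of_exists_subsingleton_ext
      (Module.annihilator R M) 2 (ModuleCat.of R R)
      (by simpa [lt_top_iff_ne_top] using hann) (ModuleCat.of R M)
      Module.support_eq_zeroLocus
      (by intro i hi; interval_cases i; exacts [h0, hn])
    match rs, hl with
    | [x, y], _ =>
      have hx := hreg.toIsWeaklyRegular
      rw [RingTheory.Sequence.isWeaklyRegular_cons_iff,
        RingTheory.Sequence.isWeaklyRegular_cons_iff] at hx
      have := supportDim_add_two_le M (hrs x (by simp)) (hrs y (by simp)) hx.1 hx.2.1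
      rw [← h] at this
      have hb : Module.supportDim R M ≠ ⊥ := Module.supportDim_ne_bot_of_nontrivial R M
      have ht : Module.supportDim R M ≠ ⊤ := fun ht => hd (top_le_iff.1
        (ht ▸ Module.supportDim_le_ringKrullDim R M))
      induction hh : Module.supportDim R M with
      | bot => exact hb hh
      | coe x =>
        induction x with
        | top => exact ht hh
        | coe x =>
          rw [hh] at this
          have : x + 1 + 1 ≤ x + 1 := by exact_mod_cast this
          omega
  refine le_antisymm (iInf₂_le_of_le 1 h1 (by simp)) (le_iInf₂ fun i hi => ?_)
  rcases Nat.eq_zero_or_pos i with rfl | hpos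
  · exact absurd h0 (not_subsingleton_iff_nontrivial.2 hi)
  · exact_mod_cast hpos

/-- In codimension one, perfection means projective dimension at most one. Projective dimension zero
is impossible as a torsion module embeds into a free module only if it is zero. -/
theorem isPerfectModule_iff [IsNoetherianRing R] [Module.Finite R M] (hd : ringKrullDim R ≠ ⊤)
    (h : HasCodim R M 1) :
    IsPerfectModule R M ↔ HasProjectiveDimensionLE (ModuleCat.of R M) 1 := by
  have hg := moduleGrade_eq_one M hd h
  constructor
  · rintro ⟨g, hp, hg'⟩
    rw [hg] at hg'
    have : g = 1 := by exact_mod_cast hg'.symm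
    subst this
    exact (projectiveDimension_le_iff _ _).1 hp.le
  · intro hp
    refine ⟨1, le_antisymm ((projectiveDimension_le_iff _ _).2 hp) ?_, by simpa using hg⟩
    rw [projectiveDimension_ge_iff]
    intro hlt
    rw [← projective_iff_hasProjectiveDimensionLT_one, ← IsProjective.iff_projective] at hlt
    obtain ⟨a, ha, ha0⟩ := exists_annihilator_ne_zero M hd h
    obtain ⟨s, hs⟩ := Module.projective_lifting_property
      (Finsupp.linearCombination R (id : M → M)) LinearMap.id
      (fun x => ⟨Finsupp.single x 1, by simp⟩)
    rw [linearMap_eq_zero_of_annihilator ha ha0 s, LinearMap.comp_zero] at hs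
    obtain ⟨x, hx⟩ := @exists_ne M (nontrivial_of_hasCodim M h) 0
    exact hx (by simpa using (LinearMap.congr_fun hs x).symm)

end Perfect

/-! ### Heights of maximal ideals of affine domains -/

section AffineDimension

/-- All maximal ideals of a polynomial ring in `n` variables over a field have height `n`: each
variable adds one, since maximal ideals contract to maximal ideals in Jacobson rings. -/
theorem MvPolynomial.height_eq_of_isMaximal (K : Type v) [Field K] (n : ℕ)
    (P : Ideal (MvPolynomial (Fin n) K)) [P.IsMaximal] : P.height = n := by
  induction n with
  | zero =>
    have hP : P = ⊥ := by
      let e := MvPolynomial.isEmptyAlgEquiv K (Fin 0)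
      have hf : IsField (MvPolynomial (Fin 0) K) := e.toMulEquiv.isField (Field.toIsField K)
      let _ := hf.toField
      exact (Ideal.eq_bot_or_top P).resolve_right (Ideal.IsMaximal.ne_top ‹_›)
    subst hP
    simp
  | succ n ih =>
    let e := (MvPolynomial.finSuccEquiv K n).toRingEquiv
    let Q : Ideal (Polynomial (MvPolynomial (Fin n) K)) := P.comap e.symm
    have hQ : Q.IsMaximal := Ideal.comap_isMaximal_of_equiv e.symm
    have h1 : (Q.comap Polynomial.C).IsMaximal :=
      Polynomial.isMaximal_comap_C_of_isJacobsonRing Q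
    have h2 : Q.LiesOver (Q.comap Polynomial.C) := ⟨rfl⟩
    have h3 := Polynomial.height_eq_height_add_one (Q.comap Polynomial.C) Q
    rw [ih (Q.comap Polynomial.C)] at h3
    rw [← RingEquiv.height_comap e.symm P]
    exact_mod_cast h3

/-- In an affine domain all maximal ideals have the same height. The domain is integral over a
polynomial ring by Noether normalization, and going-down holds because polynomial rings over fields
are normal. -/
theorem Ideal.height_eq_ringKrullDim_of_finiteType (K : Type v) [Field K] (R : Type u) [CommRing R]
    [IsDomain R] [IsNoetherianRing R] [Algebra K R] [Algebra.FiniteType K R] (m : Ideal R)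
    [m.IsMaximal] : (m.height : WithBot ℕ∞) = ringKrullDim R ∧ ringKrullDim R ≠ ⊤ := by
  obtain ⟨s, g, hg, hfin⟩ := exists_finite_inj_algHom_of_fg K R
  algebraize [g.toRingHom]
  have hint : Algebra.IsIntegral (MvPolynomial (Fin s) K) R := ⟨hfin.to_isIntegral⟩
  have : FaithfulSMul (MvPolynomial (Fin s) K) R :=
    (faithfulSMul_iff_algebraMap_injective _ _).2 hg
  let q := m.under (MvPolynomial (Fin s) K)
  have hq : q.IsMaximal := Ideal.isMaximal_comap_of_isIntegral_of_isMaximal m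
  have h1 := Ideal.height_eq_height_add_of_liesOver_of_hasGoingDown q m
  rw [MvPolynomial.height_eq_of_isMaximal K s q] at h1
  have h2 : ringKrullDim R ≤ (s : WithBot ℕ∞) := by
    have h3 : ringKrullDim R ≤ ringKrullDim (MvPolynomial (Fin s) K) :=
      Order.krullDim_le_of_strictMono (PrimeSpectrum.comap (algebraMap (MvPolynomial (Fin s) K) R))
        fun p q hpq => Ideal.IsIntegral.comap_lt_comap (show p.asIdeal < q.asIdeal from hpq)
    simpa using h3
  refine ⟨le_antisymm (Ideal.height_le_ringKrullDim_of_ne_top (Ideal.IsMaximal.ne_top ‹_›))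
    (h2.trans ?_), ?_⟩
  · rw [h1]
    exact_mod_cast le_self_add
  · rintro h
    rw [h, top_le_iff] at h2
    exact ENat.natCast_ne_top s (WithBot.coe_injective h2)

end AffineDimension

/-! ### Local rings and standard graded algebras -/

section GradedLocal

variable {Γ : Type v} [AddCommGroup Γ] [DecidableEq Γ] {R : Type u} [CommRing R]

/-- The common features of the maximal ideal of a Noetherian local ring and of the irrelevant
maximal ideal of a standard graded domain: its height is the (finite) dimension of the ring, and
the homogeneous elements outside it are units. -/
structure IsGradedLocal (𝒜 : Γ → AddSubgroup R) (m : Ideal R) : Prop where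
  isMaximal : m.IsMaximal
  height_eq : (m.height : WithBot ℕ∞) = ringKrullDim R
  dim_ne_top : ringKrullDim R ≠ ⊤
  isUnit : ∀ i, ∀ x ∈ 𝒜 i, x ∉ m → IsUnit x

theorem isGradedLocal_trivialGrading (R : Type u) [CommRing R] [IsNoetherianRing R]
    [IsLocalRing R] : IsGradedLocal (trivialGrading R) (IsLocalRing.maximalIdeal R) where
  isMaximal := inferInstance
  height_eq := IsLocalRing.maximalIdeal_height_eq_ringKrullDim
  dim_ne_top := ringKrullDim_ne_top
  isUnit _ x _ hx := by simpa using hx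

section Standard

variable {K : Type*} [Field K] [Algebra K R] {𝒜 : ℤ → AddSubgroup R}

theorem IsStandardGraded.isUnit_of_mem_zero (h : IsStandardGraded K 𝒜) {x : R} (hx : x ∈ 𝒜 0)
    (hx0 : x ≠ 0) : IsUnit x := by
  obtain ⟨k, rfl⟩ : x ∈ Set.range (algebraMap K R) := h.zero_eq ▸ hx
  have hk : k ≠ 0 := by rintro rfl; simp at hx0
  exact (IsUnit.mk0 k hk).map (algebraMap K R)

variable [GradedRing 𝒜]

/-- Taking components of degree zero is multiplicative, as there are no negative degrees. -/
theorem IsStandardGraded.decompose_zero_mul (h : IsStandardGraded K 𝒜) (x y : R) :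
    (DirectSum.decompose 𝒜 (x * y) 0 : R) =
      DirectSum.decompose 𝒜 x 0 * DirectSum.decompose 𝒜 y 0 := by
  classical
  induction x using DirectSum.Decomposition.inductionOn 𝒜 with
  | zero => simp
  | add x x' hx hx' =>
    simp only [add_mul, DirectSum.decompose_add, DirectSum.add_apply, AddSubgroup.coe_add, hx, hx']
  | @homogeneous i x =>
    induction y using DirectSum.Decomposition.inductionOn 𝒜 with
    | zero => simp
    | add y y' hy hy' =>
      simp only [mul_add, DirectSum.decompose_add, DirectSum.add_apply, AddSubgroup.coe_add, hy,
        hy']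
    | @homogeneous j y =>
      obtain ⟨x, hx⟩ := x
      obtain ⟨y, hy⟩ := y
      have hxy : x * y ∈ 𝒜 (i + j) := SetLike.GradedMul.mul_mem hx hy
      dsimp only
      rcases lt_trichotomy i 0 with hi | hi | hi
      · rw [h.eq_bot_of_neg i hi, AddSubgroup.mem_bot] at hx
        simp [hx]
      · subst hi
        rw [DirectSum.decompose_of_mem_same 𝒜 hx]
        by_cases hj : j = 0
        · subst hj
          rw [DirectSum.decompose_of_mem_same 𝒜 hy,
            DirectSum.decompose_of_mem_same 𝒜 (by simpa using hxy)]
        · rw [DirectSum.decompose_of_mem_ne 𝒜 hy hj, mul_zero,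
            DirectSum.decompose_of_mem_ne 𝒜 hxy (by simpa using hj)]
      · rw [DirectSum.decompose_of_mem_ne 𝒜 hx hi.ne', zero_mul]
        rcases lt_or_ge j 0 with hj | hj
        · rw [h.eq_bot_of_neg j hj, AddSubgroup.mem_bot] at hy
          simp [hy]
        · exact DirectSum.decompose_of_mem_ne 𝒜 hxy (by omega)

/-- The irrelevant ideal of a standard graded algebra: the elements without component of degree
zero. -/
def IsStandardGraded.irrelevant (h : IsStandardGraded K 𝒜) : Ideal R where
  carrier := {x | (DirectSum.decompose 𝒜 x 0 : R) = 0}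
  zero_mem' := by simp
  add_mem' := by
    intro x y hx hy
    have hx : (DirectSum.decompose 𝒜 x 0 : R) = 0 := hx
    have hy : (DirectSum.decompose 𝒜 y 0 : R) = 0 := hy
    change (DirectSum.decompose 𝒜 (x + y) 0 : R) = 0
    simp [hx, hy]
  smul_mem' := by
    intro c x hx
    have hx : (DirectSum.decompose 𝒜 x 0 : R) = 0 := hx
    change (DirectSum.decompose 𝒜 (c * x) 0 : R) = 0
    rw [h.decompose_zero_mul, hx, mul_zero]

theorem IsStandardGraded.mem_irrelevant (h : IsStandardGraded K 𝒜) {x : R} :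
    x ∈ h.irrelevant ↔ (DirectSum.decompose 𝒜 x 0 : R) = 0 := Iff.rfl

theorem IsStandardGraded.isMaximal_irrelevant [Nontrivial R] (h : IsStandardGraded K 𝒜) :
    h.irrelevant.IsMaximal := by
  rw [Ideal.isMaximal_iff]
  refine ⟨?_, fun J x hJ hx hxJ => ?_⟩
  · rw [h.mem_irrelevant, DirectSum.decompose_of_mem_same 𝒜 (SetLike.GradedOne.one_mem)]
    exact one_ne_zero
  · rw [h.mem_irrelevant] at hx
    have hu := h.isUnit_of_mem_zero (DirectSum.decompose 𝒜 x 0).2 hx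
    have h1 : x - DirectSum.decompose 𝒜 x 0 ∈ J := by
      apply hJ
      rw [h.mem_irrelevant, DirectSum.decompose_sub, DirectSum.sub_apply, AddSubgroup.coe_sub,
        DirectSum.decompose_of_mem_same 𝒜 (DirectSum.decompose 𝒜 x 0).2, sub_self]
    have h2 : (DirectSum.decompose 𝒜 x 0 : R) ∈ J := by simpa using J.sub_mem hxJ h1
    rw [J.eq_top_of_isUnit_mem h2 hu]
    trivial

/-- A Noetherian standard graded algebra is of finite type: if linear forms `x_1, …, x_n` generate
the ideal generated by all linear forms, then they span the space of linear forms, as one sees by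
taking components of degree one. -/
theorem IsStandardGraded.finiteType [IsNoetherianRing R] (h : IsStandardGraded K 𝒜) :
    Algebra.FiniteType K R := by
  classical
  obtain ⟨s, hs, hspan⟩ := Submodule.fg_span_iff_fg_span_finset_subset (𝒜 1 : Set R) |>.1
    (IsNoetherian.noetherian (Ideal.span (𝒜 1 : Set R)))
  refine ⟨⟨s, ?_⟩⟩
  rw [eq_top_iff, ← h.adjoin_one, Algebra.adjoin_le_iff]
  intro y hy
  have hy' : y ∈ Submodule.span R (s : Set R) := hspan ▸ Submodule.subset_span hy
  rw [Submodule.mem_span_finset] at hy'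
  obtain ⟨f, -, hf⟩ := hy'
  have hcomp : y = ∑ x ∈ s, (DirectSum.decompose 𝒜 (f x) 0 : R) * x := by
    conv_lhs => rw [← DirectSum.decompose_of_mem_same 𝒜 hy, ← hf]
    rw [DirectSum.decompose_sum, DirectSum.sum_apply, AddSubmonoidClass.coe_finsetSum]
    refine Finset.sum_congr rfl fun x hx => ?_
    have := DirectSum.coe_decompose_mul_add_of_right_mem 𝒜 (i := 0) (a := f x) (hs hx)
    rw [zero_add] at this
    exact this
  rw [hcomp]
  refine Subalgebra.sum_mem _ fun x hx => Subalgebra.mul_mem _ ?_ (Algebra.subset_adjoin hx)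
  obtain ⟨k, hk⟩ : (DirectSum.decompose 𝒜 (f x) 0 : R) ∈ Set.range (algebraMap K R) :=
    h.zero_eq ▸ (DirectSum.decompose 𝒜 (f x) 0).2
  rw [← hk]
  exact Subalgebra.algebraMap_mem _ k

theorem IsStandardGraded.isGradedLocal [IsDomain R] [IsNoetherianRing R]
    (h : IsStandardGraded K 𝒜) : IsGradedLocal 𝒜 h.irrelevant := by
  have h1 := h.finiteType
  have h2 := h.isMaximal_irrelevant
  have h3 := Ideal.height_eq_ringKrullDim_of_finiteType K R h.irrelevant
  refine ⟨h2, h3.1, h3.2, fun i x hx hxm => ?_⟩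
  rw [h.mem_irrelevant] at hxm
  by_cases hi : i = 0
  · subst hi
    rw [DirectSum.decompose_of_mem_same 𝒜 hx] at hxm
    exact h.isUnit_of_mem_zero hx hxm
  · exact absurd (DirectSum.decompose_of_mem_ne 𝒜 hx hi) hxm

end Standard

end GradedLocal

/-! ### Modules of projective dimension at most one -/

section ProjectiveDimension

variable {R : Type u} [CommRing R]

theorem projective_ker_of_hasProjectiveDimensionLE {F M : Type u} [AddCommGroup F] [Module R F]
    [AddCommGroup M] [Module R M] [Module.Projective R F] (f : F →ₗ[R] M)
    (hf : Function.Surjective f) (hM : HasProjectiveDimensionLE (ModuleCat.of R M) 1) :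
    Module.Projective R (LinearMap.ker f) := by
  have hS := LinearMap.shortExact_shortComplexKer hf
  have h2 : Projective (ModuleCat.of R F) := (IsProjective.iff_projective F).1 inferInstance
  have h1 : HasProjectiveDimensionLT (ModuleCat.of R (LinearMap.ker f)) 1 :=
    (hS.hasProjectiveDimensionLT_X₃_iff 0 h2).1 hM
  rw [← projective_iff_hasProjectiveDimensionLT_one, ← IsProjective.iff_projective] at h1
  exact h1

theorem hasProjectiveDimensionLE_ker {C M : Type u} [AddCommGroup C] [Module R C]
    [AddCommGroup M] [Module R M] (f : C →ₗ[R] M) (hf : Function.Surjective f)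
    (hC : HasProjectiveDimensionLE (ModuleCat.of R C) 1)
    (hM : HasProjectiveDimensionLE (ModuleCat.of R M) 1) :
    HasProjectiveDimensionLE (ModuleCat.of R (LinearMap.ker f)) 1 := by
  have hS := LinearMap.shortExact_shortComplexKer hf
  have hM' : HasProjectiveDimensionLT (ModuleCat.of R M) 3 :=
    hasProjectiveDimensionLT_of_ge _ 2 3 (by norm_num)
  exact hS.hasProjectiveDimensionLT_X₁ 2 hC hM'

theorem hasProjectiveDimensionLE_of_projective_ker {F M : Type u} [AddCommGroup F] [Module R F]
    [AddCommGroup M] [Module R M] [Module.Projective R F] (f : F →ₗ[R] M)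
    (hf : Function.Surjective f) (h : Module.Projective R (LinearMap.ker f)) :
    HasProjectiveDimensionLE (ModuleCat.of R M) 1 := by
  have hS := LinearMap.shortExact_shortComplexKer hf
  have h2 : Projective (ModuleCat.of R F) := (IsProjective.iff_projective F).1 inferInstance
  refine (hS.hasProjectiveDimensionLT_X₃_iff 0 h2).2 ?_
  change HasProjectiveDimensionLT (ModuleCat.of R (LinearMap.ker f)) 1
  rw [← projective_iff_hasProjectiveDimensionLT_one, ← IsProjective.iff_projective]
  exact h

end ProjectiveDimension

/-! ### Cocycles and functionals on free modules -/

section Functionals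

variable {R : Type u} [CommRing R]

theorem exists_dotProduct_eq {n : ℕ} (G : (Fin n → R) →ₗ[R] R) :
    ∃ x : Fin n → R, ∀ v, G v = x ⬝ᵥ v := by
  refine ⟨fun i => G (Pi.single i 1), fun v => ?_⟩
  rw [LinearMap.pi_apply_eq_sum_univ G v, dotProduct]
  refine Finset.sum_congr rfl fun i _ => ?_
  rw [smul_eq_mul, mul_comm]
  congr 2
  ext j
  simp [Pi.single_apply, eq_comm]

theorem transpose_mulVec_dotProduct {m n : ℕ} (A : Matrix (Fin m) (Fin n) R) (x : Fin m → R)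
    (v : Fin n → R) : A.transpose.mulVec x ⬝ᵥ v = x ⬝ᵥ A.mulVec v := by
  rw [Matrix.dotProduct_mulVec, Matrix.mulVec_transpose]

/-- If the image of `A₀` is projective, then it is a direct summand of the free module, and the
functionals vanishing on `ker A₀ = im A₁` form a direct summand of the dual free module. -/
theorem projective_ker_transpose {n₀ n₁ n₂ : ℕ} (A₀ : Matrix (Fin n₀) (Fin n₁) R)
    (A₁ : Matrix (Fin n₁) (Fin n₂) R) (hex : Function.Exact A₁.mulVecLin A₀.mulVecLin)
    (hp : Module.Projective R (LinearMap.range A₀.mulVecLin)) :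
    Module.Projective R (LinearMap.ker A₁.transpose.mulVecLin) := by
  obtain ⟨s, hs⟩ := Module.projective_lifting_property A₀.mulVecLin.rangeRestrict LinearMap.id
    A₀.mulVecLin.surjective_rangeRestrict
  let p := LinearMap.toMatrix' (s ∘ₗ A₀.mulVecLin.rangeRestrict)
  have hpv : ∀ v, p.mulVec v = s (A₀.mulVecLin.rangeRestrict v) := fun v => by
    rw [← Matrix.toLin'_apply, Matrix.toLin'_toMatrix']; rfl
  have hmem : ∀ y, p.transpose.mulVecLin y ∈ LinearMap.ker A₁.transpose.mulVecLin := by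
    intro y
    rw [LinearMap.mem_ker]
    refine dotProduct_eq _ _ fun v => ?_
    simp only [Matrix.mulVecLin_apply]
    rw [transpose_mulVec_dotProduct, transpose_mulVec_dotProduct, hpv]
    have : A₀.mulVecLin.rangeRestrict (A₁.mulVec v) = 0 := by
      ext1
      exact (hex _).2 ⟨v, rfl⟩
    rw [this]; simp
  refine Module.Projective.of_split (LinearMap.ker A₁.transpose.mulVecLin).subtype
    (p.transpose.mulVecLin.codRestrict _ hmem) ?_
  ext1 ⟨y, hy⟩
  ext1
  refine dotProduct_eq _ _ fun v => ?_
  simp only [LinearMap.comp_apply, LinearMap.codRestrict_apply, Submodule.subtype_apply,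
    Matrix.mulVecLin_apply, LinearMap.id_apply]
  rw [transpose_mulVec_dotProduct, ← sub_eq_zero, ← dotProduct_sub]
  obtain ⟨u, hu⟩ := (hex (p.mulVec v - v)).1 (by
    rw [map_sub, sub_eq_zero, hpv]
    exact congrArg Subtype.val (LinearMap.congr_fun hs (A₀.mulVecLin.rangeRestrict v)))
  rw [← hu, Matrix.mulVecLin_apply, ← transpose_mulVec_dotProduct]
  have : A₁.transpose.mulVec y = 0 := hy
  rw [this, zero_dotProduct]

/-- Let `(b₀, b₁)` be the beginning of a chain map between free resolutions of `ker f` and of `C`,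
lifting the inclusion of the kernel of an epimorphism `f : C → M`. If the syzygy module
`ker (Q₀ → C → M)` of `M` is projective, then each cocycle of the dual resolution of `ker f` comes
from a cocycle of the dual resolution of `C`, up to a coboundary: the syzygy module is the quotient
of `Q_1 ⊕ P_0` by the relations coming from `P_1` and `Q_2`, and as this quotient splits,
functionals on the relations extend to `Q_1 ⊕ P_0`. -/
theorem exists_cocycle_lift {q₀ q₁ q₂ p₀ p₁ p₂ : ℕ}
    {Q₀ : Matrix (Fin q₀) (Fin q₁) R} {Q₁ : Matrix (Fin q₁) (Fin q₂) R}
    {P₀ : Matrix (Fin p₀) (Fin p₁) R} {P₁ : Matrix (Fin p₁) (Fin p₂) R}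
    {b₀ : Matrix (Fin q₀) (Fin p₀) R} {b₁ : Matrix (Fin q₁) (Fin p₁) R}
    (hb : Q₀ * b₁ = b₀ * P₀)
    {C M : Type u} [AddCommGroup C] [Module R C] [AddCommGroup M] [Module R M] (f : C →ₗ[R] M)
    (aQ : (Fin q₀ → R) →ₗ[R] C) (hQ₀ : Function.Exact Q₀.mulVecLin aQ)
    (hQ₁ : Function.Exact Q₁.mulVecLin Q₀.mulVecLin)
    (aP : (Fin p₀ → R) →ₗ[R] LinearMap.ker f) (haP : Function.Surjective aP)
    (hP₀ : Function.Exact P₀.mulVecLin aP) (hP₁ : Function.Exact P₁.mulVecLin P₀.mulVecLin)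
    (hab : ∀ v, aQ (b₀.mulVec v) = aP v)
    (hW : Module.Projective R (LinearMap.ker (f ∘ₗ aQ)))
    (y : Fin p₁ → R) (hy : P₁.transpose.mulVec y = 0) :
    ∃ (x : Fin q₁ → R) (h : Fin p₀ → R), Q₁.transpose.mulVec x = 0 ∧
      y = b₁.transpose.mulVec x + P₀.transpose.mulVec h := by
  let Ψ₀ : (Fin q₁ → R) × (Fin p₀ → R) →ₗ[R] (Fin q₀ → R) := Q₀.mulVecLin.coprod b₀.mulVecLin
  have hΨ₀ : ∀ a p, Ψ₀ (a, p) = Q₀.mulVec a + b₀.mulVec p := fun a p => rfl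
  have haQ₀ : ∀ a, aQ (Q₀.mulVec a) = 0 := fun a => (hQ₀ _).2 ⟨a, rfl⟩
  let Ψ : (Fin q₁ → R) × (Fin p₀ → R) →ₗ[R] LinearMap.ker (f ∘ₗ aQ) :=
    Ψ₀.codRestrict _ fun ⟨a, p⟩ => by
      rw [LinearMap.mem_ker, LinearMap.comp_apply, hΨ₀, map_add, haQ₀, hab, zero_add]
      exact (aP p).2
  have hΨs : Function.Surjective Ψ := by
    rintro ⟨w, hw⟩
    obtain ⟨p, hp⟩ := haP ⟨aQ w, hw⟩
    obtain ⟨a, ha⟩ := (hQ₀ (w - b₀.mulVec p)).1 (by rw [map_sub, hab, hp, sub_self])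
    refine ⟨(a, p), Subtype.ext ?_⟩
    change Q₀.mulVec a + b₀.mulVec p = w
    rw [Matrix.mulVecLin_apply] at ha
    rw [ha, sub_add_cancel]
  obtain ⟨τ, hτ⟩ := Module.projective_lifting_property Ψ LinearMap.id hΨs
  -- elements of the kernel of `Ψ` have second component in the image of `P₀`
  have hker : ∀ z, Ψ z = 0 → z.2 ∈ LinearMap.range P₀.mulVecLin := by
    rintro ⟨a, p⟩ hz
    have hz' : Q₀.mulVec a + b₀.mulVec p = 0 := congrArg Subtype.val hz
    refine (hP₀ p).1 (Subtype.ext ?_)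
    rw [← hab, eq_neg_of_add_eq_zero_right hz', map_neg, haQ₀, neg_zero]
    rfl
  -- the retraction onto the kernel of `Ψ`, followed by the second projection
  let ρ : (Fin q₁ → R) × (Fin p₀ → R) →ₗ[R] LinearMap.range P₀.mulVecLin :=
    (LinearMap.snd R _ _ ∘ₗ (LinearMap.id - τ ∘ₗ Ψ)).codRestrict _ fun z => by
      refine hker (z - τ (Ψ z)) ?_
      have := LinearMap.congr_fun hτ (Ψ z)
      simp only [LinearMap.comp_apply, LinearMap.id_apply] at this
      simp [this]
  have hρ : ∀ z, Ψ z = 0 → (ρ z : Fin p₀ → R) = z.2 := by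
    intro z hz
    change (z - τ (Ψ z)).2 = z.2
    rw [hz, map_zero, sub_zero]
  let Y : (Fin p₁ → R) →ₗ[R] R := dotProductBilin R R y
  have hY : LinearMap.ker P₀.mulVecLin ≤ LinearMap.ker Y := by
    intro t ht
    obtain ⟨t', rfl⟩ := (hP₁ t).1 ht
    change y ⬝ᵥ P₁.mulVec t' = 0
    rw [← transpose_mulVec_dotProduct, hy, zero_dotProduct]
  let Y' : LinearMap.range P₀.mulVecLin →ₗ[R] R :=
    (LinearMap.ker P₀.mulVecLin).liftQ Y hY ∘ₗ P₀.mulVecLin.quotKerEquivRange.symm.toLinearMap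
  have hY' : ∀ t, Y' ⟨P₀.mulVec t, t, rfl⟩ = y ⬝ᵥ t := by
    intro t
    have : P₀.mulVecLin.quotKerEquivRange.symm ⟨P₀.mulVec t, t, rfl⟩ =
        Submodule.Quotient.mk t := by
      rw [LinearEquiv.symm_apply_eq]; rfl
    change (LinearMap.ker P₀.mulVecLin).liftQ Y hY
      (P₀.mulVecLin.quotKerEquivRange.symm ⟨P₀.mulVec t, t, rfl⟩) = _
    rw [this]; rfl
  obtain ⟨x, hx⟩ := exists_dotProduct_eq (Y' ∘ₗ ρ ∘ₗ LinearMap.inl R _ _)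
  obtain ⟨h, hh⟩ := exists_dotProduct_eq (Y' ∘ₗ ρ ∘ₗ LinearMap.inr R _ _)
  refine ⟨-x, h, ?_, ?_⟩
  · refine dotProduct_eq _ _ fun v => ?_
    rw [transpose_mulVec_dotProduct, neg_dotProduct, ← hx, zero_dotProduct, neg_eq_zero]
    have h0 : Ψ (Q₁.mulVec v, 0) = 0 := by
      ext1
      change Q₀.mulVec (Q₁.mulVec v) + b₀.mulVec 0 = 0
      rw [Matrix.mulVec_zero, add_zero]
      exact (hQ₁ _).2 ⟨v, rfl⟩
    have h1 : ρ (Q₁.mulVec v, 0) = 0 := Subtype.ext (hρ _ h0)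
    change Y' (ρ (Q₁.mulVec v, 0)) = 0
    rw [h1, map_zero]
  · refine dotProduct_eq _ _ fun t => ?_
    rw [add_dotProduct, transpose_mulVec_dotProduct, transpose_mulVec_dotProduct, neg_dotProduct,
      ← hx, ← hh, ← hY']
    have h0 : Ψ (-(b₁.mulVec t), P₀.mulVec t) = 0 := by
      ext1
      change Q₀.mulVec (-(b₁.mulVec t)) + b₀.mulVec (P₀.mulVec t) = 0
      rw [Matrix.mulVec_neg, Matrix.mulVec_mulVec, Matrix.mulVec_mulVec, hb, neg_add_cancel]
    have h1 : ρ (-(b₁.mulVec t), P₀.mulVec t) = ⟨P₀.mulVec t, t, rfl⟩ := Subtype.ext (hρ _ h0)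
    rw [← h1, ← map_neg (Y' ∘ₗ ρ ∘ₗ LinearMap.inl R _ _)]
    simp only [LinearMap.comp_apply, ← map_add]
    simp

end Functionals

/-! ### Perfection is invariant under liaison -/

section LinkImage

variable {Γ : Type v} [AddCommGroup Γ] [DecidableEq Γ] {R : Type u} [CommRing R]
  [IsNoetherianRing R] {𝒜 : Γ → AddSubgroup R} [GradedRing 𝒜]

theorem DirectlyLinked.symm {M N : GrMod 𝒜} (h : DirectlyLinked M N) : DirectlyLinked N M := by
  obtain ⟨C, q, φ, ψ, h1, h2, h3, h4⟩ := h
  exact ⟨C, q, ψ, φ, h2, h1, h4, h3⟩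

variable [IsDomain R]

/-- The module `Ext^1(K, R)` of a torsion module `K` of projective dimension at most one has
projective dimension at most one: dualizing `0 → P_0' → P_0 → K → 0` gives a resolution of it. -/
theorem FreeRes.hasProjectiveDimensionLE_ext_one {K : GrMod 𝒜} (P : FreeRes K)
    (hK : HasProjectiveDimensionLE (ModuleCat.of R K) 1) {r : R}
    (hr : r ∈ Module.annihilator R K) (hr0 : r ≠ 0) :
    HasProjectiveDimensionLE (ModuleCat.of R (P.ext 1)) 1 := by
  have hB : Module.Projective R (LinearMap.range (P.mat 0).mulVecLin) := by
    have := projective_ker_of_hasProjectiveDimensionLE P.aug.lin P.surjective hK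
    rwa [LinearMap.exact_iff.1 P.exact_zero] at this
  have hZ : Module.Projective R (LinearMap.ker (P.dualMap 1).lin) :=
    projective_ker_transpose (P.mat 0) (P.mat 1) (P.exact_succ 0) hB
  refine hasProjectiveDimensionLE_of_projective_ker (Submodule.mkQ
    ((P.coboundaries 1).comap (GrMod.kerIncl (P.dualMap 1)).lin)) (Submodule.mkQ_surjective _) ?_
  rw [Submodule.ker_mkQ]
  have hinj : Function.Injective (P.dualMap 0).lin := by
    rw [injective_iff_map_eq_zero]
    intro x hx
    have hx : (P.mat 0).transpose.mulVec x = 0 := hx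
    ext i
    obtain ⟨u, hu⟩ := (P.exact_zero (r • Pi.single i 1)).1 (by
      rw [map_smul]; exact Module.mem_annihilator.1 hr _)
    have h1 : x ⬝ᵥ (r • Pi.single i (1 : R)) = 0 := by
      rw [← hu, Matrix.mulVecLin_apply, ← transpose_mulVec_dotProduct, hx, zero_dotProduct]
    change x i = 0
    simpa [hr0] using h1
  have hcob : ∀ x, (P.dualMap 0).lin x ∈ LinearMap.ker (P.dualMap 1).lin := by
    intro x
    refine dotProduct_eq _ _ fun v => ?_
    change (P.mat 1).transpose.mulVec ((P.mat 0).transpose.mulVec x) ⬝ᵥ v = (0 : Fin _ → R) ⬝ᵥ v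
    rw [transpose_mulVec_dotProduct, transpose_mulVec_dotProduct]
    have : (P.mat 0).mulVec ((P.mat 1).mulVec v) = 0 := (P.exact_succ 0 _).2 ⟨v, rfl⟩
    rw [this]; simp
  let e : P.dualTerm 0 →ₗ[R]
      ((P.coboundaries 1).comap (GrMod.kerIncl (P.dualMap 1)).lin) :=
    ((P.dualMap 0).lin.codRestrict _ hcob).codRestrict _ fun x => ⟨x, rfl⟩
  have he : Function.Bijective e := by
    constructor
    · intro x y hxy
      exact hinj (congrArg Subtype.val (congrArg Subtype.val hxy))
    · rintro ⟨⟨z, hz⟩, ⟨x, hx⟩⟩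
      exact ⟨x, Subtype.ext (Subtype.ext hx)⟩
  have hfree : Module.Projective R (P.dualTerm 0) :=
    inferInstanceAs (Module.Projective R (Fin (P.rank 0) → R))
  exact Module.Projective.of_equiv' (LinearEquiv.ofBijective e he)

/-- The projective dimension of a linked module. The connecting sequence of
`0 → ker φ → C → M → 0` shows that `L_C(φ)` maps onto `Ext^1(ker φ, R)`, as `Ext^2(M, R) = 0`. -/
theorem IsLinkImage.hasProjectiveDimensionLE {C M N : GrMod 𝒜} {q : QuasiGorenstein C}
    (hq : q.c = 1) {φ : GrHom C M} (hφ : Function.Surjective φ.lin)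
    (hC : HasProjectiveDimensionLE (ModuleCat.of R C) 1)
    (hM : HasProjectiveDimensionLE (ModuleCat.of R M) 1) {r : R}
    (hr : r ∈ Module.annihilator R C) (hr0 : r ≠ 0) (h : IsLinkImage q φ N) :
    HasProjectiveDimensionLE (ModuleCat.of R N) 1 := by
  obtain ⟨P, B, ⟨e⟩⟩ := h
  obtain ⟨hperf, c, hcodim, Q, s, α⟩ := q
  change c = 1 at hq
  subst hq
  change ResLift P Q (GrMod.kerIncl φ) at B
  have hK : HasProjectiveDimensionLE (ModuleCat.of R (LinearMap.ker φ.lin)) 1 :=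
    hasProjectiveDimensionLE_ker φ.lin hφ hC hM
  have hrK : r ∈ Module.annihilator R (LinearMap.ker φ.lin) := by
    rw [Module.mem_annihilator] at hr ⊢
    intro x
    ext1
    exact hr x
  have hE := P.hasProjectiveDimensionLE_ext_one hK hrK hr0
  have hW : Module.Projective R (LinearMap.ker (φ.lin ∘ₗ Q.aug.lin)) := by
    have : Module.Projective R (GrMod.free 𝒜 (Q.deg 0)) :=
      inferInstanceAs (Module.Projective R (Fin (Q.rank 0) → R))
    exact projective_ker_of_hasProjectiveDimensionLE _ (hφ.comp Q.surjective) hM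
  have hsurj : Function.Surjective (B.extMap 1).lin := by
    intro z
    obtain ⟨⟨y, hy⟩, rfl⟩ := Submodule.mkQ_surjective _ z
    obtain ⟨x, h, hx, hxy⟩ := exists_cocycle_lift (B.comm 0) φ.lin Q.aug.lin Q.exact_zero
      (Q.exact_succ 0) P.aug.lin P.surjective P.exact_zero (P.exact_succ 0) B.comm_aug hW y hy
    refine ⟨Submodule.mkQ _ ⟨x, hx⟩, ?_⟩
    refine (Submodule.Quotient.eq _).2 ⟨-h, ?_⟩
    change (P.mat 0).transpose.mulVec (-h) = (B.mat 1).transpose.mulVec x - y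
    rw [hxy, Matrix.mulVec_neg]
    abel
  let q' : QuasiGorenstein C := ⟨hperf, 1, hcodim, Q, s, α⟩
  have hL : Function.Surjective (linkHom q' φ P B).lin := hsurj.comp α.lin.surjective
  have e' : N ≃ₗ[R] P.ext 1 := e.lin.trans (LinearEquiv.ofTop _ (LinearMap.range_eq_top.2 hL))
  exact ModuleCat.hasProjectiveDimensionLE_of_linearEquiv (M := ModuleCat.of R (P.ext 1))
    (N := ModuleCat.of R N) e'.symm 1

/-- A module directly linked to a perfect module of codimension one is again perfect of codimension
one. -/
theorem DirectlyLinked.isPerfectModule {M N : GrMod 𝒜} (hd : ringKrullDim R ≠ ⊤)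
    (h : DirectlyLinked M N) (hM : IsPerfectModule R M ∧ HasCodim R M 1) :
    IsPerfectModule R N ∧ HasCodim R N 1 := by
  obtain ⟨C, q, φ, ψ, ⟨hφ, hφd⟩, ⟨-, hψd⟩, -, hN⟩ := h
  have hCc : HasCodim R C 1 := by
    have := hM.2
    rwa [HasCodim, hφd] at this
  have hNc : HasCodim R N 1 := by
    rwa [HasCodim, hψd]
  have hq : q.c = 1 :=
    natCast_eq_of_add_eq hd (ringKrullDim_ne_bot_of_nontrivial R) q.hasCodim hCc
  obtain ⟨r, hr, hr0⟩ := exists_annihilator_ne_zero C hd hCc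
  exact ⟨(isPerfectModule_iff N hd hNc).2 (hN.hasProjectiveDimensionLE hq hφ
    ((isPerfectModule_iff C hd hCc).1 q.isPerfect) ((isPerfectModule_iff M hd hM.2).1 hM.1)
    hr hr0), hNc⟩

theorem SameLiaisonClass.isPerfectModule_iff {M N : GrMod 𝒜} (hd : ringKrullDim R ≠ ⊤)
    (h : SameLiaisonClass M N) :
    (IsPerfectModule R M ∧ HasCodim R M 1) ↔ (IsPerfectModule R N ∧ HasCodim R N 1) := by
  induction h with
  | rel M N h => exact ⟨h.isPerfectModule hd, h.symm.isPerfectModule hd⟩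
  | refl M => exact Iff.rfl
  | symm M N _ ih => exact ih.symm
  | trans M N L _ _ ih1 ih2 => exact ih1.trans ih2

end LinkImage

/-! ### Graded projective modules are free -/

section Generators

variable {Γ : Type v} [AddCommGroup Γ] [DecidableEq Γ] {R : Type u} [CommRing R]
  {𝒜 : Γ → AddSubgroup R}

/-- Homogeneous elements `x k` of degrees `d k` generating a graded module. -/
def GrMod.IsGenerating (M : GrMod 𝒜) {n : ℕ} (d : Fin n → Γ) (x : Fin n → M) : Prop :=
  (∀ k, x k ∈ M.gr (d k)) ∧ Submodule.span R (Set.range x) = ⊤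

/-- The homogeneous components of finitely many generators are homogeneous generators. -/
theorem GrMod.exists_isGenerating (M : GrMod 𝒜) :
    ∃ (n : ℕ) (d : Fin n → Γ) (x : Fin n → M), M.IsGenerating d x := by
  classical
  obtain ⟨S, hS⟩ := (Module.Finite.fg_top : (⊤ : Submodule R M).FG)
  choose t ht using fun x : M => exists_grComp_sum M.isInternal x
  let I := (x : S) × (t x.1)
  let e : Fin (Fintype.card I) ≃ I := (Fintype.equivFin I).symm
  refine ⟨Fintype.card I, fun k => (e k).2.1,
    fun k => grComp M.isInternal (e k).2.1 (e k).1.1, fun k => grComp_mem _ _ _, ?_⟩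
  rw [eq_top_iff, ← hS, Submodule.span_le]
  intro x hx
  refine SetLike.mem_coe.2 (?_ : x ∈ Submodule.span R _)
  refine (ht x).symm ▸ (?_ : (∑ i ∈ t x, grComp M.isInternal i x) ∈ Submodule.span R _)
  refine Submodule.sum_mem _ fun i hi => Submodule.subset_span ⟨e.symm ⟨⟨x, hx⟩, ⟨i, hi⟩⟩, ?_⟩
  dsimp only
  rw [e.apply_symm_apply]

variable [GradedRing 𝒜]

/-- The graded homomorphism from a graded free module given by homogeneous elements. -/
def GrMod.ofElements (M : GrMod 𝒜) {n : ℕ} {d : Fin n → Γ} {x : Fin n → M}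
    (hx : ∀ k, x k ∈ M.gr (d k)) : GrHom (GrMod.free 𝒜 d) M where
  lin := Fintype.linearCombination R x
  map_mem i v hv := by
    rw [Fintype.linearCombination_apply]
    refine AddSubgroup.sum_mem _ fun k _ => ?_
    have h := M.smul_mem (hv k) (hx k)
    rwa [sub_add_cancel] at h

theorem GrMod.ofElements_apply (M : GrMod 𝒜) {n : ℕ} {d : Fin n → Γ} {x : Fin n → M}
    (hx : ∀ k, x k ∈ M.gr (d k)) (v : Fin n → R) :
    (M.ofElements hx).lin v = ∑ k, v k • x k :=
  Fintype.linearCombination_apply R x v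

theorem GrMod.IsGenerating.surjective {M : GrMod 𝒜} {n : ℕ} {d : Fin n → Γ} {x : Fin n → M}
    (h : M.IsGenerating d x) : Function.Surjective (M.ofElements h.1).lin := by
  rw [← LinearMap.range_eq_top]
  exact (Fintype.range_linearCombination R x).trans h.2

/-- The coefficients of the relations between the members of a minimal homogeneous generating
system lie in the maximal ideal: a relation with a coefficient outside it has a homogeneous
component with a unit among its coefficients. -/
theorem GrMod.IsGenerating.mem_of_minimal {m : Ideal R} (hm : IsGradedLocal 𝒜 m) {M : GrMod 𝒜}
    {n : ℕ} {d : Fin n → Γ} {x : Fin n → M} (h : M.IsGenerating d x)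
    (hmin : ∀ n' < n, ¬ ∃ (d' : Fin n' → Γ) (x' : Fin n' → M), M.IsGenerating d' x')
    (v : Fin n → R) (hv : (M.ofElements h.1).lin v = 0) (k : Fin n) : v k ∈ m := by
  by_contra hk
  obtain ⟨s, hs⟩ := exists_grComp_sum (GrMod.free 𝒜 d).isInternal v
  obtain ⟨i, -, hi⟩ : ∃ i ∈ s, grComp (GrMod.free 𝒜 d).isInternal i v k ∉ m := by
    by_contra! H
    apply hk
    have := congrFun hs k
    rw [Finset.sum_apply] at this
    rw [this]
    exact Ideal.sum_mem _ H
  obtain ⟨w, hw⟩ : ∃ w, w = grComp (GrMod.free 𝒜 d).isInternal i v := ⟨_, rfl⟩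
  have hu : IsUnit (w k) := hm.isUnit _ _
    (by rw [hw]; exact grComp_mem (GrMod.free 𝒜 d).isInternal i v k) (by rw [hw]; exact hi)
  have hw0 : ∑ j, w j • x j = 0 := by
    rw [← M.ofElements_apply h.1, hw, ← GrHom.grComp_map, hv, map_zero]
  obtain ⟨n, rfl⟩ : ∃ n', n = n' + 1 := ⟨n - 1, by have := k.2; omega⟩
  refine hmin n (by omega) ⟨d ∘ k.succAbove, x ∘ k.succAbove, fun j => h.1 _, ?_⟩
  rw [eq_top_iff, ← h.2, Submodule.span_le]
  rintro _ ⟨j, rfl⟩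
  rcases Fin.eq_self_or_eq_succAbove k j with rfl | ⟨j', rfl⟩
  · rw [Fin.sum_univ_succAbove _ j] at hw0
    have h1 : w j • x j ∈ Submodule.span R (Set.range (x ∘ j.succAbove)) := by
      rw [eq_neg_of_add_eq_zero_left hw0]
      exact Submodule.neg_mem _ (Submodule.sum_mem _ fun l _ =>
        Submodule.smul_mem _ _ (Submodule.subset_span ⟨l, rfl⟩))
    obtain ⟨u, hu⟩ := hu
    have h2 := Submodule.smul_mem _ (↑u⁻¹ : R) h1
    rwa [smul_smul, ← hu, Units.inv_mul, one_smul] at h2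
  · exact Submodule.subset_span ⟨j', rfl⟩

/-- A graded projective module is graded free: a minimal homogeneous generating system is a basis.
The kernel `Z` of the corresponding map from a free module is a direct summand contained in `m`
times the free module, hence `Z = m Z`, and an element of `1 + m` annihilates the torsion-free
module `Z`. -/
theorem GrMod.exists_basis_of_projective [IsDomain R] [IsNoetherianRing R] {m : Ideal R}
    (hm : IsGradedLocal 𝒜 m) (K : GrMod 𝒜) (hK : Module.Projective R K) :
    ∃ (n : ℕ) (d : Fin n → Γ) (x : Fin n → K) (h : K.IsGenerating d x),
      Function.Injective (K.ofElements h.1).lin := by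
  classical
  have hex := K.exists_isGenerating
  obtain ⟨d, x, h⟩ := Nat.find_spec hex
  have hmin := fun n' (hn' : n' < Nat.find hex) => Nat.find_min hex hn'
  refine ⟨_, d, x, h, ?_⟩
  obtain ⟨s, hs⟩ := Module.projective_lifting_property (K.ofElements h.1).lin LinearMap.id
    h.surjective
  generalize hπ : (K.ofElements h.1).lin = π at hs
  have hπm : ∀ v : Fin _ → R, π v = 0 → ∀ k, v k ∈ m := fun v hv k =>
    h.mem_of_minimal hm hmin v (by rw [hπ]; exact hv) k
  rw [← LinearMap.ker_eq_bot]
  have hle : LinearMap.ker π ≤ m • LinearMap.ker π := by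
    intro v hv
    have hρ : ∀ w, w - s (π w) ∈ LinearMap.ker π := fun w => by
      have := LinearMap.congr_fun hs (π w)
      simp only [LinearMap.comp_apply, LinearMap.id_apply] at this
      rw [LinearMap.mem_ker, map_sub, this, sub_self]
    have h1 : v = ∑ k, (v k) • ((Pi.single k (1 : R) : Fin _ → R) -
        s (π (Pi.single k (1 : R) : Fin _ → R))) := by
      have h2 : ∑ k, (v k) • (Pi.single k (1 : R) : Fin _ → R) = v := by
        ext j; simp [Pi.single_apply]
      have h3 : ∑ k, (v k) • s (π (Pi.single k (1 : R) : Fin _ → R)) = s (π v) := by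
        conv_rhs => rw [← h2]
        simp only [map_sum, map_smul]
      simp only [smul_sub, Finset.sum_sub_distrib, h2, h3]
      rw [LinearMap.mem_ker.1 hv, map_zero, sub_zero]
    rw [h1]
    exact Submodule.sum_mem _ fun k _ =>
      Submodule.smul_mem_smul (hπm v hv k) (hρ (Pi.single k (1 : R) : Fin _ → R))
  have hN : IsNoetherian R (GrMod.free 𝒜 d) :=
    inferInstanceAs (IsNoetherian R (Fin (Nat.find hex) → R))
  have hfg : (LinearMap.ker π).FG := hN.noetherian _
  obtain ⟨r, hr, hr0⟩ := Submodule.exists_sub_one_mem_and_smul_eq_zero_of_fg_of_le_smul m _ hfg hle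
  have hrne : r ≠ 0 := by
    rintro rfl
    apply hm.isMaximal.ne_top
    rw [Ideal.eq_top_iff_one]
    simpa using m.neg_mem hr
  rw [eq_bot_iff]
  intro v hv
  have h4 := hr0 v hv
  ext k
  have h5 : r * v k = 0 := congrFun h4 k
  exact (mul_eq_zero.1 h5).resolve_left hrne

theorem mulVec_eq_sum_smul {n k : ℕ} (A : Matrix (Fin n) (Fin k) R) (v : Fin k → R) :
    A.mulVec v = ∑ j, v j • fun i => A i j := by
  ext i
  simp [Matrix.mulVec, dotProduct, mul_comm]

/-- A torsion module of projective dimension at most one has a square presentation matrix with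
nonzero determinant: the first syzygy module is graded free, and it has full rank in the free module
since `r • Rⁿ` is contained in it. -/
theorem hasSquarePresentation_of_hasProjectiveDimensionLE [IsDomain R] [IsNoetherianRing R]
    {m : Ideal R} (hm : IsGradedLocal 𝒜 m) {M : GrMod 𝒜}
    (hM : HasProjectiveDimensionLE (ModuleCat.of R M) 1) {r : R}
    (hr : r ∈ Module.annihilator R M) (hr0 : r ≠ 0) : HasSquarePresentation M := by
  classical
  obtain ⟨n, d, x, hx⟩ := M.exists_isGenerating
  let π := M.ofElements hx.1
  have hfree : Module.Projective R (GrMod.free 𝒜 d) :=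
    inferInstanceAs (Module.Projective R (Fin n → R))
  have hK := projective_ker_of_hasProjectiveDimensionLE π.lin hx.surjective hM
  obtain ⟨k, e, y, hy, hinj⟩ := GrMod.exists_basis_of_projective hm (GrMod.ker π) hK
  let A : Matrix (Fin n) (Fin k) R := fun i j => (y j).1 i
  have hA : ∀ v, A.mulVec v = (((GrMod.ker π).ofElements hy.1).lin v).1 := by
    intro v
    rw [GrMod.ofElements_apply, mulVec_eq_sum_smul]
    exact (map_sum (LinearMap.ker π.lin).subtype (fun j => v j • y j) Finset.univ).symm
  have hAinj : Function.Injective A.mulVecLin := by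
    intro v w hvw
    apply hinj
    ext1
    rw [← hA, ← hA]
    exact hvw
  have hex : Function.Exact A.mulVecLin π.lin := by
    intro w
    constructor
    · intro hw
      obtain ⟨v, hv⟩ := hy.surjective ⟨w, hw⟩
      exact ⟨v, by rw [Matrix.mulVecLin_apply, hA, hv]⟩
    · rintro ⟨v, rfl⟩
      rw [Matrix.mulVecLin_apply, hA]
      exact (((GrMod.ker π).ofElements hy.1).lin v).2
  have h1 : k ≤ n := by
    simpa using card_le_of_injective R A.mulVecLin hAinj
  have h2 : n ≤ k := by
    have hmem : ∀ w : Fin n → R, r • w ∈ LinearMap.range A.mulVecLin := fun w =>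
      (hex _).1 (by rw [map_smul]; exact Module.mem_annihilator.1 hr _)
    let g : (Fin n → R) →ₗ[R] (Fin k → R) :=
      (LinearEquiv.ofInjective A.mulVecLin hAinj).symm.toLinearMap ∘ₗ
        (r • LinearMap.id).codRestrict (LinearMap.range A.mulVecLin) hmem
    have hg : Function.Injective g := by
      refine (LinearEquiv.ofInjective A.mulVecLin hAinj).symm.injective.comp fun v w hvw => ?_
      have h3 : r • v = r • w := congrArg Subtype.val hvw
      ext i
      have h4 : r * v i = r * w i := congrFun h3 i
      exact mul_left_cancel₀ hr0 h4
    simpa using card_le_of_injective R g hg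
  obtain rfl : n = k := le_antisymm h2 h1
  refine ⟨n, d, e, A, π, fun i j => hy.1 j i, ?_, hx.surjective, hex⟩
  intro hdet
  obtain ⟨v, hv, hv0⟩ := Matrix.exists_mulVec_eq_zero_iff.2 hdet
  exact hv (hAinj (by simpa using hv0))

end Generators

/-! ### Homogeneous presentation matrices -/

section Presentation

variable {Γ : Type v} [AddCommGroup Γ] [DecidableEq Γ] {R : Type u} [CommRing R]
  {𝒜 : Γ → AddSubgroup R}

/-- Homogeneity of a matrix with arbitrary finite index types, with respect to row degrees `d` and
column degrees `e`. -/
def HomogeneousEntries (𝒜 : Γ → AddSubgroup R) {ι κ : Type*} (d : ι → Γ) (e : κ → Γ)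
    (A : Matrix ι κ R) : Prop :=
  ∀ j k, A j k ∈ 𝒜 (e k - d j)

/-- The graded module `M` is the cokernel of the matrix `A`, the generators having the degrees `d`.
The index types are arbitrary, so that block matrices can be used. -/
def GrMod.IsPresentedBy (M : GrMod 𝒜) {ι κ : Type*} [Fintype ι] [Fintype κ] (d : ι → Γ)
    (A : Matrix ι κ R) : Prop :=
  ∃ π : (ι → R) →ₗ[R] M, Function.Surjective π ∧ Function.Exact A.mulVecLin π ∧
    ∀ i v, (∀ k, v k ∈ 𝒜 (i - d k)) → π v ∈ M.gr i

variable {ι κ : Type*} [Fintype ι] [Fintype κ]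

/-- The cokernel depends only on the image of the matrix. -/
theorem GrMod.IsPresentedBy.of_range_eq {M : GrMod 𝒜} {κ' : Type*} [Fintype κ'] {d : ι → Γ}
    {A : Matrix ι κ R} {B : Matrix ι κ' R} (h : M.IsPresentedBy d A)
    (hAB : LinearMap.range A.mulVecLin = LinearMap.range B.mulVecLin) : M.IsPresentedBy d B := by
  obtain ⟨π, h1, h2, h3⟩ := h
  refine ⟨π, h1, ?_, h3⟩
  rw [LinearMap.exact_iff] at h2 ⊢
  rw [h2, hAB]

theorem GrMod.IsPresentedBy.reindex {M : GrMod 𝒜} {ι' κ' : Type*} [Fintype ι'] [Fintype κ']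
    (f : ι' ≃ ι) (g : κ' ≃ κ) {d : ι → Γ} {A : Matrix ι κ R} (h : M.IsPresentedBy d A) :
    M.IsPresentedBy (d ∘ f) (A.submatrix f g) := by
  obtain ⟨π, h1, h2, h3⟩ := h
  let F : (ι' → R) ≃ₗ[R] (ι → R) := LinearEquiv.funCongrLeft R R f.symm
  have hF : ∀ v i, F v i = v (f.symm i) := fun v i => rfl
  refine ⟨π ∘ₗ F.toLinearMap, h1.comp F.surjective, ?_, ?_⟩
  · intro v
    have hiff := h2 (F v)
    change π (F v) = 0 ↔ _
    rw [hiff]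
    constructor
    · rintro ⟨w, hw⟩
      refine ⟨w ∘ g, ?_⟩
      rw [Matrix.mulVecLin_apply, Matrix.submatrix_mulVec_equiv]
      ext i
      have := congrFun hw (f i)
      rw [Matrix.mulVecLin_apply, hF] at this
      simpa [Function.comp_assoc] using this
    · rintro ⟨w, rfl⟩
      refine ⟨w ∘ g.symm, ?_⟩
      ext i
      rw [hF, Matrix.mulVecLin_apply, Matrix.mulVecLin_apply, Matrix.submatrix_mulVec_equiv]
      simp
  · intro i v hv
    refine h3 i (F v) fun k => ?_
    have := hv (f.symm k)
    simpa [hF] using this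

theorem GrMod.IsPresentedBy.nontrivial_of_le {M N : GrMod 𝒜} {κ' : Type*} [Fintype κ'] {d : ι → Γ}
    {A : Matrix ι κ R} {B : Matrix ι κ' R} (hM : M.IsPresentedBy d A) (hN : N.IsPresentedBy d B)
    (h : LinearMap.range B.mulVecLin ≤ LinearMap.range A.mulVecLin) (hnt : Nontrivial M) :
    Nontrivial N := by
  obtain ⟨π, h1, h2, -⟩ := hM
  obtain ⟨ρ, -, g2, -⟩ := hN
  obtain ⟨x, hx⟩ := exists_ne (0 : M)
  obtain ⟨v, rfl⟩ := h1 x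
  refine ⟨ρ v, 0, fun h0 => hx ?_⟩
  exact (h2 v).2 (h ((g2 v).1 h0))

variable [DecidableEq ι]

theorem GrMod.IsPresentedBy.det_mem_annihilator {M : GrMod 𝒜} {d : ι → Γ} {A : Matrix ι ι R}
    (h : M.IsPresentedBy d A) : A.det ∈ Module.annihilator R M := by
  obtain ⟨π, h1, h2, -⟩ := h
  rw [Module.mem_annihilator]
  intro x
  obtain ⟨v, rfl⟩ := h1 x
  rw [← map_smul]
  refine (h2 _).2 ⟨A.adjugate.mulVec v, ?_⟩
  rw [Matrix.mulVecLin_apply, Matrix.mulVec_mulVec, Matrix.mul_adjugate, Matrix.smul_mulVec,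
    Matrix.one_mulVec]

/-- If `r` annihilates `coker A`, then `r • 1 = A * B` for some `B`, and thus a power of `r` is a
multiple of `det A`. -/
theorem GrMod.IsPresentedBy.det_dvd_pow {M : GrMod 𝒜} {d : ι → Γ} {A : Matrix ι ι R}
    (h : M.IsPresentedBy d A) {r : R} (hr : r ∈ Module.annihilator R M) :
    A.det ∣ r ^ Fintype.card ι := by
  obtain ⟨π, h1, h2, -⟩ := h
  have hb : ∀ k, ∃ b, A.mulVec b = r • Pi.single k (1 : R) := fun k =>
    (h2 _).1 (by rw [map_smul]; exact Module.mem_annihilator.1 hr _)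
  choose b hb using hb
  let B : Matrix ι ι R := Matrix.of fun i k => b k i
  have hAB : A * B = r • (1 : Matrix ι ι R) := by
    ext i k
    have := congrFun (hb k) i
    simpa [Matrix.mul_apply, Matrix.mulVec, dotProduct, B, Matrix.one_apply, Pi.single_apply]
      using this
  refine ⟨B.det, ?_⟩
  rw [← Matrix.det_mul, hAB, Matrix.det_smul, Matrix.det_one, mul_one]

theorem mulVec_injective_of_det_ne_zero [IsDomain R] {A : Matrix ι ι R} (hA : A.det ≠ 0) :
    Function.Injective A.mulVec := by
  intro v w h
  by_contra hvw
  exact hA (Matrix.exists_mulVec_eq_zero_iff.1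
    ⟨v - w, sub_ne_zero.2 hvw, by rw [Matrix.mulVec_sub, h, sub_self]⟩)

theorem det_ne_zero_of_mulVec_eq_zero [IsDomain R] {A : Matrix ι ι R}
    (hA : ∀ v, A.mulVec v = 0 → v = 0) : A.det ≠ 0 := by
  intro h
  obtain ⟨v, hv, hv0⟩ := Matrix.exists_mulVec_eq_zero_iff.2 h
  exact hv (hA v hv0)

variable [GradedRing 𝒜]

theorem HasSquarePresentation.exists_isPresentedBy {M : GrMod 𝒜} (h : HasSquarePresentation M) :
    ∃ (n : ℕ) (d e : Fin n → Γ) (A : Matrix (Fin n) (Fin n) R),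
      HomogeneousEntries 𝒜 d e A ∧ A.det ≠ 0 ∧ M.IsPresentedBy d A := by
  obtain ⟨n, d, e, A, π, h1, h2, h3, h4⟩ := h
  exact ⟨n, d, e, A, h1, h2, π.lin, h3, h4, π.map_mem⟩

theorem HomogeneousEntries.mul {ι κ ν : Type*} [Fintype κ] {d : ι → Γ} {e : κ → Γ} {f : ν → Γ}
    {A : Matrix ι κ R} {B : Matrix κ ν R} (hA : HomogeneousEntries 𝒜 d e A)
    (hB : HomogeneousEntries 𝒜 e f B) : HomogeneousEntries 𝒜 d f (A * B) := by
  intro i j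
  rw [Matrix.mul_apply]
  refine AddSubgroup.sum_mem _ fun k _ => ?_
  have h := SetLike.GradedMul.mul_mem (hA i k) (hB k j)
  have he : e k - d i + (f j - e k) = f j - d i := by abel
  rwa [he] at h

theorem HomogeneousEntries.det_mem {d e : ι → Γ} {A : Matrix ι ι R}
    (hA : HomogeneousEntries 𝒜 d e A) : A.det ∈ 𝒜 (∑ i, e i - ∑ i, d i) := by
  rw [Matrix.det_apply]
  refine AddSubgroup.sum_mem _ fun σ _ => ?_
  have h := SetLike.prod_mem_graded (A := 𝒜) (F := Finset.univ) (i := fun i => e i - d (σ i))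
    (g := fun i => A (σ i) i) (hF := fun i _ => hA (σ i) i)
  rw [Finset.sum_sub_distrib, Equiv.sum_comp σ d] at h
  rcases Int.units_eq_one_or (Equiv.Perm.sign σ) with h1 | h1
  · rw [h1, one_smul]; exact h
  · rw [h1, Units.neg_smul, one_smul]; exact AddSubgroup.neg_mem _ h

variable [IsDomain R]

/-- The support of `coker A` is the zero locus of `det A`, a nonzero element of the maximal
ideal. -/
theorem GrMod.IsPresentedBy.hasCodim [IsNoetherianRing R] {m : Ideal R} (hm : IsGradedLocal 𝒜 m)
    {M : GrMod 𝒜} {d e : ι → Γ} {A : Matrix ι ι R} (h : M.IsPresentedBy d A)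
    (hA : HomogeneousEntries 𝒜 d e A) (hdet : A.det ≠ 0) (hM : Nontrivial M) :
    HasCodim R M 1 := by
  have hnu : ¬ IsUnit A.det := by
    intro hu
    obtain ⟨x, hx⟩ := exists_ne (0 : M)
    obtain ⟨u, hu⟩ := hu
    have h0 := Module.mem_annihilator.1 h.det_mem_annihilator x
    apply hx
    rw [← one_smul R x, ← u.inv_mul, mul_smul, hu, h0, smul_zero]
  have hmem : A.det ∈ m := by
    by_contra hn
    exact hnu (hm.isUnit _ _ hA.det_mem hn)
  have hprime := hm.isMaximal.isPrime
  have hdim := Module.ringKrullDim_quotient_add_one_of_mem_nonZeroDivisors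
    (mem_nonZeroDivisors_of_ne_zero hdet) hm.height_eq hmem
  have hsupp : Module.support R M = Module.support R (R ⧸ Ideal.span {A.det}) := by
    ext p
    rw [Module.mem_support_iff_of_finite, Module.mem_support_iff_of_finite,
      Ideal.annihilator_quotient, Ideal.span_singleton_le_iff_mem]
    refine ⟨fun hp => hp h.det_mem_annihilator, fun hp r hr => ?_⟩
    exact p.2.mem_of_pow_mem _ (p.asIdeal.mem_of_dvd (h.det_dvd_pow hr) hp)
  rw [HasCodim, Module.supportDim, hsupp, ← Module.supportDim,
    Module.supportDim_quotient_eq_ringKrullDim]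
  exact_mod_cast hdim

theorem GrMod.IsPresentedBy.isPerfectModule [IsNoetherianRing R] {m : Ideal R}
    (hm : IsGradedLocal 𝒜 m) {M : GrMod 𝒜} {n : ℕ} {d e : Fin n → Γ}
    {A : Matrix (Fin n) (Fin n) R} (h : M.IsPresentedBy d A)
    (hA : HomogeneousEntries 𝒜 d e A) (hdet : A.det ≠ 0) (hM : Nontrivial M) :
    IsPerfectModule R M ∧ HasCodim R M 1 := by
  have hc := h.hasCodim hm hA hdet hM
  refine ⟨(isPerfectModule_iff M hm.dim_ne_top hc).2 ?_, hc⟩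
  obtain ⟨π, h1, h2, -⟩ := h
  refine hasProjectiveDimensionLE_of_projective_ker π h1 ?_
  rw [LinearMap.exact_iff.1 h2]
  exact Module.Projective.of_equiv' (LinearEquiv.ofInjective A.mulVecLin
    (mulVec_injective_of_det_ne_zero hdet))

/-- Perfection in codimension one in terms of square presentation matrices. -/
theorem isPerfectModule_iff_hasSquarePresentation [IsNoetherianRing R] {m : Ideal R}
    (hm : IsGradedLocal 𝒜 m) (M : GrMod 𝒜) :
    IsPerfectModule R M ∧ HasCodim R M 1 ↔ Nontrivial M ∧ HasSquarePresentation M := by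
  constructor
  · rintro ⟨h1, h2⟩
    obtain ⟨r, hr, hr0⟩ := exists_annihilator_ne_zero M hm.dim_ne_top h2
    exact ⟨nontrivial_of_hasCodim M h2, hasSquarePresentation_of_hasProjectiveDimensionLE hm
      ((isPerfectModule_iff M hm.dim_ne_top h2).1 h1) hr hr0⟩
  · rintro ⟨h1, h2⟩
    obtain ⟨n, d, e, A, hA, hdet, h⟩ := h2.exists_isPresentedBy
    exact h.isPerfectModule hm hA hdet h1

end Presentation

/-! ### Graded quotients -/

section GradedQuotients

variable {Γ : Type v} [AddCommGroup Γ] [DecidableEq Γ] {R : Type u} [CommRing R]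
  {𝒜 : Γ → AddSubgroup R}

theorem GrHom.exists_homogeneous_preimage {F X : GrMod 𝒜} (f : GrHom F X)
    (hf : Function.Surjective f.lin) {i : Γ} {x : X} (hx : x ∈ X.gr i) :
    ∃ v ∈ F.gr i, f.lin v = x := by
  obtain ⟨w, rfl⟩ := hf x
  exact ⟨grComp F.isInternal i w, grComp_mem _ _ _, by rw [← f.grComp_map, grComp_same _ hx]⟩

/-- Two graded quotients of the same graded module by the same kernel are isomorphic. -/
theorem GrIso.exists_of_ker_eq {F X Y : GrMod 𝒜} (f : GrHom F X) (g : GrHom F Y)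
    (hf : Function.Surjective f.lin) (hg : Function.Surjective g.lin)
    (h : LinearMap.ker f.lin = LinearMap.ker g.lin) :
    ∃ e : GrIso X Y, ∀ v, e.lin (f.lin v) = g.lin v := by
  let e : X ≃ₗ[R] Y := (f.lin.quotKerEquivOfSurjective hf).symm.trans
    ((Submodule.quotEquivOfEq _ _ h).trans (g.lin.quotKerEquivOfSurjective hg))
  have he : ∀ v, e (f.lin v) = g.lin v := by
    intro v
    have h1 : (f.lin.quotKerEquivOfSurjective hf).symm (f.lin v) = Submodule.Quotient.mk v := by
      rw [LinearEquiv.symm_apply_eq]; rfl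
    change (g.lin.quotKerEquivOfSurjective hg) (Submodule.quotEquivOfEq _ _ h
      ((f.lin.quotKerEquivOfSurjective hf).symm (f.lin v))) = _
    rw [h1, Submodule.quotEquivOfEq_mk]; rfl
  refine ⟨⟨e, fun i x => ⟨fun hx => ?_, fun hx => ?_⟩⟩, he⟩
  · obtain ⟨v, hv, hvx⟩ := g.exists_homogeneous_preimage hg hx
    have : f.lin v = x := e.injective (by rw [he, hvx])
    exact this ▸ f.map_mem i v hv
  · obtain ⟨v, hv, rfl⟩ := f.exists_homogeneous_preimage hf hx
    rw [he]
    exact g.map_mem i v hv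

end GradedQuotients

/-! ### Resolutions of length one and their Ext modules -/

section ShortResolutions

variable {Γ : Type v} [AddCommGroup Γ] [DecidableEq Γ] {R : Type u} [CommRing R]
  {𝒜 : Γ → AddSubgroup R} [GradedRing 𝒜]

/-- The graded free resolution `0 → F_1 → F_0 → K → 0` given by an injective square matrix. -/
def FreeRes.ofInjective {K : GrMod 𝒜} {n : ℕ} {d e : Fin n → Γ} {A : Matrix (Fin n) (Fin n) R}
    (hA : IsHomogeneousMatrix 𝒜 d e A) (π : GrHom (GrMod.free 𝒜 d) K)
    (hπ : Function.Surjective π.lin) (hex : Function.Exact A.mulVecLin π.lin)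
    (hinj : Function.Injective A.mulVec) : FreeRes K where
  rank
    | 0 => n
    | 1 => n
    | _ + 2 => 0
  deg
    | 0 => d
    | 1 => e
    | _ + 2 => Fin.elim0
  mat
    | 0 => A
    | _ + 1 => 0
  homogeneous
    | 0 => hA
    | _ + 1 => fun _ k => Fin.elim0 k
  aug := π
  surjective := hπ
  exact_zero := hex
  exact_succ
    | 0 => by
      intro v
      constructor
      · intro hv
        exact ⟨0, (map_zero _).trans (hinj (hv.trans (Matrix.mulVec_zero A).symm)).symm⟩
      · rintro ⟨w, rfl⟩
        change A.mulVec ((0 : Matrix (Fin n) (Fin 0) R).mulVec w) = 0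
        rw [Matrix.zero_mulVec, Matrix.mulVec_zero]
    | _ + 1 => fun v => ⟨fun _ => ⟨0, funext fun k => Fin.elim0 k⟩, fun _ => funext fun k => by
        simp⟩

variable [IsNoetherianRing R]

/-- If the second term of a short resolution has the generator degrees `s - d`, then
`Ext^1_R(K, R)(-s)` is a quotient of the free module with generator degrees `d`, and the kernel of
the quotient map is the image of the transposed matrix. -/
theorem FreeRes.exists_extOneHom {K : GrMod 𝒜} {n : ℕ} {d e : Fin n → Γ} {s : Γ}
    {B : Matrix (Fin n) (Fin n) R} (hB : IsHomogeneousMatrix 𝒜 e (fun k => s - d k) B)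
    (π : GrHom (GrMod.free 𝒜 e) K) (hπ : Function.Surjective π.lin)
    (hex : Function.Exact B.mulVecLin π.lin) (hinj : Function.Injective B.mulVec) :
    ∃ f : GrHom (GrMod.free 𝒜 d) (((FreeRes.ofInjective hB π hπ hex hinj).ext 1).shift (-s)),
      Function.Surjective f.lin ∧
      LinearMap.ker f.lin = LinearMap.range B.transpose.mulVecLin ∧
      ∀ (v : Fin n → R) (hv : _), f.lin v = Submodule.Quotient.mk ⟨v, hv⟩ := by
  let P := FreeRes.ofInjective hB π hπ hex hinj
  have hcoc : ∀ v : Fin n → R, v ∈ LinearMap.ker (P.dualMap 1).lin := fun v =>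
    funext fun k => Fin.elim0 k
  let f₀ : (Fin n → R) →ₗ[R] LinearMap.ker (P.dualMap 1).lin :=
    (LinearMap.id : (Fin n → R) →ₗ[R] (Fin n → R)).codRestrict _ hcoc
  refine ⟨⟨Submodule.mkQ _ ∘ₗ f₀, ?_⟩, ?_, ?_, fun v hv => rfl⟩
  · intro i v hv
    refine ⟨f₀ v, fun k => ?_, rfl⟩
    have h : ∀ k : Fin n, i - d k = i + -s - -(s - d k) := fun k => by abel
    have h1 : v k ∈ 𝒜 (i + -s - -(s - d k)) := h k ▸ hv k
    exact h1
  · refine (Submodule.mkQ_surjective _).comp fun z => ⟨z.1, rfl⟩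
  · ext v
    refine (Submodule.Quotient.mk_eq_zero _).trans ?_
    exact Iff.rfl

end ShortResolutions

/-! ### Linkage by cokernels of symmetric matrices -/

section Linkage

variable {Γ : Type v} [AddCommGroup Γ] [DecidableEq Γ] {R : Type u} [CommRing R]
  {𝒜 : Γ → AddSubgroup R} [GradedRing 𝒜]

/-- The cokernel of a homogeneous matrix. -/
abbrev GrMod.coker {n k : ℕ} {d : Fin n → Γ} {e : Fin k → Γ} {A : Matrix (Fin n) (Fin k) R}
    (hA : IsHomogeneousMatrix 𝒜 d e A) : GrMod 𝒜 :=
  (GrMod.free 𝒜 d).quot (LinearMap.range (matrixHom A hA).lin)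
    (GrMod.isGradedSub_range (matrixHom A hA))

/-- The projection onto the cokernel of a homogeneous matrix. -/
def GrMod.cokerHom {n k : ℕ} {d : Fin n → Γ} {e : Fin k → Γ} {A : Matrix (Fin n) (Fin k) R}
    (hA : IsHomogeneousMatrix 𝒜 d e A) : GrHom (GrMod.free 𝒜 d) (GrMod.coker hA) where
  lin := Submodule.mkQ _
  map_mem _ v hv := ⟨v, hv, rfl⟩

theorem GrMod.cokerHom_surjective {n k : ℕ} {d : Fin n → Γ} {e : Fin k → Γ}
    {A : Matrix (Fin n) (Fin k) R} (hA : IsHomogeneousMatrix 𝒜 d e A) :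
    Function.Surjective (GrMod.cokerHom hA).lin :=
  Submodule.mkQ_surjective _

theorem GrMod.cokerHom_exact {n k : ℕ} {d : Fin n → Γ} {e : Fin k → Γ}
    {A : Matrix (Fin n) (Fin k) R} (hA : IsHomogeneousMatrix 𝒜 d e A) :
    Function.Exact A.mulVecLin (GrMod.cokerHom hA).lin :=
  fun _ => Submodule.Quotient.mk_eq_zero _

theorem GrMod.coker_isPresentedBy {n k : ℕ} {d : Fin n → Γ} {e : Fin k → Γ}
    {A : Matrix (Fin n) (Fin k) R} (hA : IsHomogeneousMatrix 𝒜 d e A) :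
    (GrMod.coker hA).IsPresentedBy d A :=
  ⟨(GrMod.cokerHom hA).lin, GrMod.cokerHom_surjective hA, GrMod.cokerHom_exact hA,
    (GrMod.cokerHom hA).map_mem⟩

variable [IsNoetherianRing R]

section Symmetric

variable {n : ℕ} {d : Fin n → Γ} {s : Γ} {S : Matrix (Fin n) (Fin n) R}
  (hS : IsHomogeneousMatrix 𝒜 d (fun k => s - d k) S)

/-- The resolution of the cokernel of an injective matrix given by the matrix. -/
def FreeRes.coker (hinj : Function.Injective S.mulVec) : FreeRes (GrMod.coker hS) :=
  FreeRes.ofInjective hS (GrMod.cokerHom hS) (GrMod.cokerHom_surjective hS)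
    (GrMod.cokerHom_exact hS) hinj

theorem exists_grIso_ext_of_symmetric (hsymm : S.transpose = S)
    (hinj : Function.Injective S.mulVec) :
    ∃ α : GrIso (GrMod.coker hS) (((FreeRes.coker hS hinj).ext 1).shift (-s)),
      ∀ (v : Fin n → R) (hv : _),
        α.lin ((GrMod.cokerHom hS).lin v) = Submodule.Quotient.mk ⟨v, hv⟩ := by
  obtain ⟨f, hf, hfk, hfv⟩ := FreeRes.exists_extOneHom hS (GrMod.cokerHom hS)
    (GrMod.cokerHom_surjective hS) (GrMod.cokerHom_exact hS) hinj
  obtain ⟨α, hα⟩ := GrIso.exists_of_ker_eq (GrMod.cokerHom hS) f (GrMod.cokerHom_surjective hS) hf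
    (by rw [hfk, hsymm]; exact LinearMap.exact_iff.1 (GrMod.cokerHom_exact hS))
  exact ⟨α, fun v hv => (hα v).trans (hfv v hv)⟩

/-- The cokernel of a symmetric matrix is quasi-Gorenstein, as dualizing its resolution transposes
the matrix. The isomorphism with the Ext module is the one induced by the identity of the free
module. -/
noncomputable def QuasiGorenstein.ofSymmetric (hsymm : S.transpose = S)
    (hinj : Function.Injective S.mulVec) (hperf : IsPerfectModule R (GrMod.coker hS))
    (hcodim : HasCodim R (GrMod.coker hS) 1) : QuasiGorenstein (GrMod.coker hS) where
  isPerfect := hperf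
  c := 1
  hasCodim := hcodim
  res := FreeRes.coker hS hinj
  s := -s
  α := Classical.choose (exists_grIso_ext_of_symmetric hS hsymm hinj)

/-- If a symmetric matrix factors as `A * B`, then the kernel of `coker (A * B) → coker A` is
`coker B`, and the linked module is `Ext^1(coker B, R)`, that is, the cokernel of the transpose of
`B`. -/
theorem exists_isLinkImage (hsymm : S.transpose = S)
    (hinj : Function.Injective S.mulVec) (hperf : IsPerfectModule R (GrMod.coker hS))
    (hcodim : HasCodim R (GrMod.coker hS) 1) {e : Fin n → Γ} {A B : Matrix (Fin n) (Fin n) R}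
    (hA : IsHomogeneousMatrix 𝒜 d e A) (hB : IsHomogeneousMatrix 𝒜 e (fun k => s - d k) B)
    (hSAB : S = A * B) (hAinj : Function.Injective A.mulVec)
    (hBinj : Function.Injective B.mulVec) {M N : GrMod 𝒜}
    (hM : M.IsPresentedBy d A) (hN : N.IsPresentedBy d B.transpose) :
    ∃ φ : GrHom (GrMod.coker hS) M, Function.Surjective φ.lin ∧
      IsLinkImage (QuasiGorenstein.ofSymmetric hS hsymm hinj hperf hcodim) φ N := by
  obtain ⟨πM, hM1, hM2, hM3⟩ := hM
  obtain ⟨πN, hN1, hN2, hN3⟩ := hN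
  have hSv : ∀ v, S.mulVec v = A.mulVec (B.mulVec v) := fun v => by
    rw [hSAB, Matrix.mulVec_mulVec]
  have hle : LinearMap.range (matrixHom S hS).lin ≤ LinearMap.ker πM := by
    rintro _ ⟨v, rfl⟩
    refine (hM2 _).2 ⟨B.mulVec v, ?_⟩
    exact (hSv v).symm
  let φ : GrHom (GrMod.coker hS) M :=
    ⟨Submodule.liftQ _ πM hle, by rintro i _ ⟨v, hv, rfl⟩; exact hM3 i v hv⟩
  have hφv : ∀ v, φ.lin ((GrMod.cokerHom hS).lin v) = πM v := fun v => rfl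
  have hφ : Function.Surjective φ.lin := fun x => by
    obtain ⟨v, rfl⟩ := hM1 x
    exact ⟨(GrMod.cokerHom hS).lin v, rfl⟩
  refine ⟨φ, hφ, ?_⟩
  -- the resolution of `ker φ` given by `B`
  have hAφ : ∀ v, (GrMod.cokerHom hS).lin (A.mulVec v) ∈ LinearMap.ker φ.lin := fun v =>
    (hM2 _).2 ⟨v, rfl⟩
  let π : GrHom (GrMod.free 𝒜 e) (GrMod.ker φ) :=
    ⟨((GrMod.cokerHom hS).lin ∘ₗ A.mulVecLin).codRestrict _ hAφ, fun i v hv =>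
      (GrMod.cokerHom hS).map_mem i _ ((matrixHom A hA).map_mem i v hv)⟩
  have hπ : Function.Surjective π.lin := by
    rintro ⟨x, hx⟩
    obtain ⟨w, rfl⟩ := GrMod.cokerHom_surjective hS x
    obtain ⟨v, rfl⟩ := (hM2 w).1 hx
    exact ⟨v, rfl⟩
  have hex : Function.Exact B.mulVecLin π.lin := by
    intro v
    have h1 : π.lin v = 0 ↔ (GrMod.cokerHom hS).lin (A.mulVec v) = 0 :=
      ⟨fun h => congrArg Subtype.val h, fun h => Subtype.ext h⟩
    rw [h1, GrMod.cokerHom_exact hS (A.mulVec v)]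
    constructor
    · rintro ⟨w, hw⟩
      exact ⟨w, hAinj ((hSv w).symm.trans hw)⟩
    · rintro ⟨w, rfl⟩
      exact ⟨w, hSv w⟩
  obtain ⟨f, hf, hfk, hfv⟩ := FreeRes.exists_extOneHom hB π hπ hex hBinj
  let q := QuasiGorenstein.ofSymmetric hS hsymm hinj hperf hcodim
  let P := FreeRes.ofInjective hB π hπ hex hBinj
  -- the chain map given by `A` and the identity matrix
  let L : ResLift P q.res (GrMod.kerIncl φ) :=
    { mat := fun
        | 0 => A
        | 1 => (1 : Matrix (Fin n) (Fin n) R)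
        | _ + 2 => (0 : Matrix (Fin 0) (Fin 0) R)
      homogeneous := fun
        | 0 => hA
        | 1 => by
          change IsHomogeneousMatrix 𝒜 (fun k => s - d k) (fun k => s - d k)
            (1 : Matrix (Fin n) (Fin n) R)
          intro j k
          rw [Matrix.one_apply]
          split_ifs with hjk
          · subst hjk
            rw [sub_self]
            exact SetLike.GradedOne.one_mem
          · exact zero_mem _
        | _ + 2 => fun j => Fin.elim0 j
      comm_aug := fun v => rfl
      comm := fun
        | 0 => (Matrix.mul_one S).trans hSAB
        | _ + 1 => by
          ext j k
          exact Fin.elim0 k }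
  refine ⟨P, L, ?_⟩
  have hLv : ∀ v : Fin n → R, (linkHom q φ P L).lin ((GrMod.cokerHom hS).lin v) = f.lin v := by
    intro v
    have h0 : ∀ w : Fin n → R, w ∈ LinearMap.ker (q.res.dualMap 1).lin := fun w =>
      funext fun k => Fin.elim0 k
    have h1 := Classical.choose_spec (exists_grIso_ext_of_symmetric hS hsymm hinj) v (h0 v)
    have h2 : (linkHom q φ P L).lin ((GrMod.cokerHom hS).lin v) =
        (L.extMap 1).lin (Submodule.Quotient.mk ⟨v, h0 v⟩) := congrArg (L.extMap 1).lin h1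
    rw [h2, hfv v (funext fun k => Fin.elim0 k)]
    refine congrArg Submodule.Quotient.mk (Subtype.ext ?_)
    change (1 : Matrix (Fin n) (Fin n) R).transpose.mulVec v = v
    rw [Matrix.transpose_one, Matrix.one_mulVec]
  let g : GrHom (GrMod.free 𝒜 d) (GrMod.im (linkHom q φ P L)) :=
    ⟨(linkHom q φ P L).lin.rangeRestrict ∘ₗ (GrMod.cokerHom hS).lin, fun i v hv =>
      (linkHom q φ P L).map_mem i _ ((GrMod.cokerHom hS).map_mem i v hv)⟩
  have hg : Function.Surjective g.lin :=
    (linkHom q φ P L).lin.surjective_rangeRestrict.comp (GrMod.cokerHom_surjective hS)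
  have hker : LinearMap.ker πN = LinearMap.ker g.lin := by
    rw [LinearMap.exact_iff.1 hN2, ← hfk]
    ext v
    rw [LinearMap.mem_ker, LinearMap.mem_ker, ← hLv]
    exact ⟨fun h => Subtype.ext h, fun h => congrArg Subtype.val h⟩
  obtain ⟨α, -⟩ := GrIso.exists_of_ker_eq (X := N) (F := GrMod.free 𝒜 d) ⟨πN, hN3⟩ g hN1 hg hker
  exact ⟨α⟩

end Symmetric

variable [IsDomain R]

/-- If `A * B` is symmetric, then the cokernels of `A` and of the transpose of `B` are linked by the
cokernel of `A * B`. -/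
theorem directlyLinked_of_mul_symmetric {m : Ideal R} (hm : IsGradedLocal 𝒜 m) {n : ℕ}
    {d e : Fin n → Γ} {s : Γ} {A B : Matrix (Fin n) (Fin n) R} (hA : HomogeneousEntries 𝒜 d e A)
    (hB : HomogeneousEntries 𝒜 e (fun k => s - d k) B) (hsymm : (A * B).transpose = A * B)
    (hdA : A.det ≠ 0) (hdB : B.det ≠ 0) {M N : GrMod 𝒜} (hM : M.IsPresentedBy d A)
    (hN : N.IsPresentedBy d B.transpose) (hMn : Nontrivial M) (hNn : Nontrivial N) :
    DirectlyLinked M N := by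
  have hS : IsHomogeneousMatrix 𝒜 d (fun k => s - d k) (A * B) := hA.mul hB
  have hdS : (A * B).det ≠ 0 := by rw [Matrix.det_mul]; exact mul_ne_zero hdA hdB
  have hAT : IsHomogeneousMatrix 𝒜 (fun k => s - e k) (fun k => s - d k) A.transpose := by
    intro j k
    have h := hA k j
    have h1 : e j - d k = s - d k - (s - e j) := by abel
    rwa [h1] at h
  have hBT : IsHomogeneousMatrix 𝒜 d (fun k => s - e k) B.transpose := by
    intro j k
    have h := hB k j
    have h1 : s - d j - e k = s - e k - d j := by abel
    rwa [h1] at h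
  have hdAT : A.transpose.det ≠ 0 := by rwa [Matrix.det_transpose]
  have hdBT : B.transpose.det ≠ 0 := by rwa [Matrix.det_transpose]
  have hC := GrMod.coker_isPresentedBy hS
  have hCn : Nontrivial (GrMod.coker hS) := hM.nontrivial_of_le hC (by
    rintro _ ⟨v, rfl⟩
    exact ⟨B.mulVec v, by simp [Matrix.mulVec_mulVec]⟩) hMn
  obtain ⟨hperf, hcodim⟩ := hC.isPerfectModule hm hS hdS hCn
  have hMc := hM.hasCodim hm hA hdA hMn
  have hNc := hN.hasCodim hm hBT hdBT hNn
  have hdim : ∀ L : GrMod 𝒜, HasCodim R L 1 →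
      Module.supportDim R L = Module.supportDim R (GrMod.coker hS) := fun L hL =>
    ENat.WithBot.add_natCast_cancel.1 (hL.trans hcodim.symm)
  have hinj := mulVec_injective_of_det_ne_zero hdS
  obtain ⟨φ, hφ, hφN⟩ := exists_isLinkImage hS hsymm hinj hperf hcodim hA hB rfl
    (mulVec_injective_of_det_ne_zero hdA) (mulVec_injective_of_det_ne_zero hdB) hM hN
  obtain ⟨ψ, hψ, hψM⟩ := exists_isLinkImage hS hsymm hinj hperf hcodim hBT hAT
    (by rw [← Matrix.transpose_mul, hsymm]) (mulVec_injective_of_det_ne_zero hdBT)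
    (mulVec_injective_of_det_ne_zero hdAT) hN (by rwa [Matrix.transpose_transpose])
  exact ⟨_, _, φ, ψ, ⟨hφ, hdim M hMc⟩, ⟨hψ, hdim N hNc⟩, hψM, hφN⟩

/-- Multiplying a presentation matrix from the right by a symmetric matrix gives a linked module,
since `A * (S * Aᵀ)` is symmetric if `S` is. -/
theorem directlyLinked_mul_symmetric {m : Ideal R} (hm : IsGradedLocal 𝒜 m) {ι : Type*}
    [Fintype ι] [DecidableEq ι] {d e : ι → Γ} {s : Γ} {A S : Matrix ι ι R}
    (hA : HomogeneousEntries 𝒜 d e A) (hS : HomogeneousEntries 𝒜 e (fun k => s - e k) S)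
    (hsymm : S.transpose = S) (hdA : A.det ≠ 0) (hdS : S.det ≠ 0) {M N : GrMod 𝒜}
    (hM : M.IsPresentedBy d A) (hN : N.IsPresentedBy d (A * S)) (hMn : Nontrivial M) :
    DirectlyLinked M N := by
  have hNn : Nontrivial N := hM.nontrivial_of_le hN (by
    rintro _ ⟨v, rfl⟩
    exact ⟨S.mulVec v, by simp [Matrix.mulVec_mulVec]⟩) hMn
  let f : Fin (Fintype.card ι) ≃ ι := (Fintype.equivFin ι).symm
  have hAT : HomogeneousEntries 𝒜 (fun k => s - e k) (fun k => s - d k) A.transpose := by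
    intro j k
    have h := hA k j
    have h1 : e j - d k = s - d k - (s - e j) := by abel
    rwa [h1] at h
  have hB := hS.mul hAT
  refine directlyLinked_of_mul_symmetric hm (d := d ∘ f) (e := e ∘ f) (s := s)
    (A := A.submatrix f f) (B := (S * A.transpose).submatrix f f) (fun j k => hA _ _)
    (fun j k => hB _ _) ?_ ?_ ?_ (hM.reindex f f) ?_ hMn hNn
  · rw [Matrix.submatrix_mul_equiv, Matrix.transpose_submatrix, Matrix.transpose_mul,
      Matrix.transpose_mul, Matrix.transpose_transpose, hsymm, Matrix.mul_assoc]
  · rwa [Matrix.det_submatrix_equiv_self]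
  · rw [Matrix.det_submatrix_equiv_self, Matrix.det_mul, Matrix.det_transpose]
    exact mul_ne_zero hdS hdA
  · rw [Matrix.transpose_submatrix, Matrix.transpose_mul, Matrix.transpose_transpose, hsymm]
    exact hN.reindex f f

end Linkage

/-! ### Bordered matrices and the exchange matrix -/

section Bordering

variable {Γ : Type v} [AddCommGroup Γ] [DecidableEq Γ] {R : Type u} [CommRing R]
  {𝒜 : Γ → AddSubgroup R}

theorem fromBlocks_one_mulVec {ι κ : Type*} [Fintype ι] [Fintype κ] [DecidableEq κ]
    (A : Matrix ι ι R) (w : ι ⊕ κ → R) :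
    (Matrix.fromBlocks A 0 0 (1 : Matrix κ κ R)).mulVec w =
      Sum.elim (A.mulVec (w ∘ Sum.inl)) (w ∘ Sum.inr) := by
  rw [Matrix.fromBlocks_mulVec]
  simp

/-- Bordering a presentation matrix by an identity matrix adds superfluous generators. -/
theorem GrMod.IsPresentedBy.fromBlocks_one {M : GrMod 𝒜} {ι κ : Type*} [Fintype ι] [Fintype κ]
    [DecidableEq κ] {d : ι → Γ} {A : Matrix ι ι R} (h : M.IsPresentedBy d A) (x : κ → Γ) :
    M.IsPresentedBy (Sum.elim d x) (Matrix.fromBlocks A 0 0 (1 : Matrix κ κ R)) := by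
  obtain ⟨π, h1, h2, h3⟩ := h
  refine ⟨π ∘ₗ LinearMap.funLeft R R Sum.inl, fun y => ?_, fun w => ?_, fun i w hw => ?_⟩
  · obtain ⟨v, rfl⟩ := h1 y
    exact ⟨Sum.elim v 0, rfl⟩
  · change π (w ∘ Sum.inl) = 0 ↔ _
    rw [h2]
    constructor
    · rintro ⟨v, hv⟩
      refine ⟨Sum.elim v (w ∘ Sum.inr), ?_⟩
      rw [Matrix.mulVecLin_apply, fromBlocks_one_mulVec, Sum.elim_comp_inl, Sum.elim_comp_inr]
      rw [Matrix.mulVecLin_apply] at hv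
      rw [hv, Sum.elim_comp_inl_inr]
    · rintro ⟨v, rfl⟩
      refine ⟨v ∘ Sum.inl, ?_⟩
      rw [Matrix.mulVecLin_apply, Matrix.mulVecLin_apply, fromBlocks_one_mulVec,
        Sum.elim_comp_inl]
  · exact h3 i _ fun k => hw (Sum.inl k)

theorem HomogeneousEntries.fromBlocks_one [GradedRing 𝒜] {ι κ : Type*} [DecidableEq κ]
    {d e : ι → Γ} {A : Matrix ι ι R} (h : HomogeneousEntries 𝒜 d e A) (x : κ → Γ) :
    HomogeneousEntries 𝒜 (Sum.elim d x) (Sum.elim e x)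
      (Matrix.fromBlocks A 0 0 (1 : Matrix κ κ R)) := by
  rintro (i | i) (j | j)
  · exact h i j
  · exact zero_mem _
  · exact zero_mem _
  · change (1 : Matrix κ κ R) i j ∈ 𝒜 (x j - x i)
    rw [Matrix.one_apply]
    split_ifs with hij
    · subst hij
      rw [sub_self]
      exact SetLike.GradedOne.one_mem
    · exact zero_mem _

/-- The new matrix maps `c` to `A c' + c j • u`, where `c'` is `c` with its `j`-th entry deleted. -/
theorem updateCol_mulVec {ι κ : Type*} [Fintype κ] [DecidableEq κ] (A : Matrix ι κ R) (j : κ)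
    (u : ι → R) (c : κ → R) :
    (A.updateCol j u).mulVec c = A.mulVec (Function.update c j 0) + c j • u := by
  ext i
  simp only [Matrix.mulVec, dotProduct, Pi.add_apply, Pi.smul_apply, smul_eq_mul]
  rw [← Finset.add_sum_erase _ _ (Finset.mem_univ j),
    ← Finset.add_sum_erase _ (fun k => A i k * Function.update c j 0 k) (Finset.mem_univ j)]
  rw [Matrix.updateCol_self, Function.update_self, mul_zero, zero_add, add_comm, mul_comm]
  congr 1
  refine Finset.sum_congr rfl fun k hk => ?_
  have hkj := Finset.ne_of_mem_erase hk
  rw [Matrix.updateCol_ne hkj, Function.update_of_ne hkj]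

variable {ι : Type*} [DecidableEq ι]

/-- The symmetric matrix `[[g E_{jj}, P], [Pᵀ, 0]]`, where the columns of `P` are the standard basis
vectors except the `j`-th one. -/
def exchangeMatrix (j : ι) (g : R) : Matrix (ι ⊕ {k // k ≠ j}) (ι ⊕ {k // k ≠ j}) R :=
  Matrix.fromBlocks (Matrix.single j j g) ((1 : Matrix ι ι R).submatrix id Subtype.val)
    ((1 : Matrix ι ι R).submatrix Subtype.val id) 0

theorem exchangeMatrix_transpose (j : ι) (g : R) :
    (exchangeMatrix j g).transpose = exchangeMatrix j g := by
  rw [exchangeMatrix, Matrix.fromBlocks_transpose, Matrix.transpose_single,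
    Matrix.transpose_submatrix, Matrix.transpose_submatrix, Matrix.transpose_one,
    Matrix.transpose_zero]

variable [Fintype ι]

theorem exchangeMatrix_mulVec (j : ι) (g : R) (w : ι ⊕ {k // k ≠ j} → R) :
    (exchangeMatrix j g).mulVec w =
      Sum.elim (fun i => if h : i = j then g * w (Sum.inl j) else w (Sum.inr ⟨i, h⟩))
        (fun k : {k // k ≠ j} => w (Sum.inl k.1)) := by
  rw [exchangeMatrix, Matrix.fromBlocks_mulVec]
  congr 1
  · ext i
    have h1 : (Matrix.single j j g).mulVec (w ∘ Sum.inl) i =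
        if i = j then g * w (Sum.inl j) else 0 := by
      rw [Matrix.mulVec, dotProduct, Finset.sum_eq_single j]
      · by_cases h : i = j
        · subst h; simp
        · simp [Matrix.single_apply_of_row_ne (Ne.symm h), h]
      · intro b _ hb
        simp [Matrix.single_apply_of_col_ne _ _ (Ne.symm hb)]
      · simp
    rw [Pi.add_apply, h1]
    by_cases h : i = j
    · subst h
      simp only [Matrix.mulVec, dotProduct, Matrix.submatrix_apply, id, Matrix.one_apply,
        if_true, dif_pos]
      rw [Finset.sum_eq_zero, add_zero]
      intro k _
      simp [Ne.symm k.2]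
    · rw [if_neg h, dif_neg h, zero_add, Matrix.mulVec, dotProduct,
        Finset.sum_eq_single ⟨i, h⟩]
      · change (1 : Matrix ι ι R) i i * _ = _
        rw [Matrix.one_apply_eq, one_mul]
        rfl
      · intro k _ hk
        have : i ≠ k.1 := fun h' => hk (Subtype.ext h'.symm)
        simp [this]
      · simp
  · ext k
    simp [Matrix.mulVec, dotProduct, Matrix.one_apply]

end Bordering

/-! ### Linkage by exchanging a column -/

section ColumnExchange

variable {Γ : Type v} [AddCommGroup Γ] [DecidableEq Γ] {R : Type u} [CommRing R] [IsDomain R]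
  [IsNoetherianRing R] {𝒜 : Γ → AddSubgroup R} [GradedRing 𝒜] {m : Ideal R}
  {ι : Type*} [Fintype ι] [DecidableEq ι]

/-- Replacing one column of a presentation matrix by a linear combination of the columns in which
the replaced column occurs gives a directly linked module. The bordered matrix `[[A, 0], [0, 1]]`
multiplied by the symmetric matrix `exchangeMatrix j (v j)` has the same image as the bordered new
matrix. The degrees of the border are chosen such that the symmetric matrix is homogeneous. -/
theorem directlyLinked_updateCol (hm : IsGradedLocal 𝒜 m) {d e : ι → Γ} {A : Matrix ι ι R}
    (hA : HomogeneousEntries 𝒜 d e A) (hdA : A.det ≠ 0) {v : ι → R} {ε : Γ}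
    (hv : ∀ k, v k ∈ 𝒜 (ε - e k)) {j : ι} (hj : v j ≠ 0) {M N : GrMod 𝒜}
    (hM : M.IsPresentedBy d A) (hN : N.IsPresentedBy d (A.updateCol j (A.mulVec v)))
    (hMn : Nontrivial M) : DirectlyLinked M N := by
  let x : {k // k ≠ j} → Γ := fun k => ε + e j - e k
  have hS : HomogeneousEntries 𝒜 (Sum.elim e x) (fun k => ε + e j - Sum.elim e x k)
      (exchangeMatrix j (v j)) := by
    have h1 : ∀ i k : ι, (1 : Matrix ι ι R) i k ∈ 𝒜 (e k - e i) := by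
      intro i k
      rw [Matrix.one_apply]
      split_ifs with h
      · subst h; rw [sub_self]; exact SetLike.GradedOne.one_mem
      · exact zero_mem _
    rintro (i | i) (k | k)
    · change Matrix.single j j (v j) i k ∈ 𝒜 (ε + e j - e k - e i)
      rw [Matrix.single_apply]
      split_ifs with h
      · obtain ⟨rfl, rfl⟩ := h
        rw [add_sub_cancel_right]
        exact hv j
      · exact zero_mem _
    · have h2 : e k.1 - e i = ε + e j - (ε + e j - e k.1) - e i := by abel
      exact h2 ▸ h1 i k.1
    · have h2 : e k - e i.1 = ε + e j - e i.1 - (ε + e j - e k) := by abel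
      have h3 : ε + e j - e k - (ε + e j - e i.1) = e i.1 - e k := by abel
      change (1 : Matrix ι ι R) i.1 k ∈ 𝒜 (ε + e j - e k - (ε + e j - e i.1))
      rw [h3, Matrix.one_apply]
      split_ifs with h
      · rw [h, sub_self]; exact SetLike.GradedOne.one_mem
      · exact zero_mem _
    · exact zero_mem _
  have hdS : (exchangeMatrix j (v j)).det ≠ 0 := by
    refine det_ne_zero_of_mulVec_eq_zero fun w hw => ?_
    rw [exchangeMatrix_mulVec] at hw
    have h1 : ∀ k : {k // k ≠ j}, w (Sum.inl k.1) = 0 := fun k => congrFun hw (Sum.inr k)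
    have h2 : ∀ i, (if h : i = j then v j * w (Sum.inl j) else w (Sum.inr ⟨i, h⟩)) = 0 :=
      fun i => congrFun hw (Sum.inl i)
    ext (i | k)
    · by_cases h : i = j
      · have h3 := h2 j
        rw [dif_pos rfl] at h3
        rw [h]
        exact (mul_eq_zero.1 h3).resolve_left hj
      · exact h1 ⟨i, h⟩
    · have h3 := h2 k
      rwa [dif_neg k.2] at h3
  have hdA' : (Matrix.fromBlocks A 0 0 (1 : Matrix {k // k ≠ j} {k // k ≠ j} R)).det ≠ 0 := by
    rwa [Matrix.det_fromBlocks_zero₂₁, Matrix.det_one, mul_one]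
  refine directlyLinked_mul_symmetric hm (hA.fromBlocks_one x) hS
    (exchangeMatrix_transpose j (v j)) hdA' hdS (hM.fromBlocks_one x)
    ((hN.fromBlocks_one x).of_range_eq ?_) hMn
  -- both images consist of the pairs `(A u, w)` with `v j ∣ u j`
  apply le_antisymm
  · rintro _ ⟨w, rfl⟩
    refine ⟨Sum.elim (fun i => if h : i = j then w (Sum.inl j) else w (Sum.inr ⟨i, h⟩))
      (fun k : {k // k ≠ j} => w (Sum.inl k.1) + w (Sum.inl j) * v k), ?_⟩
    rw [Matrix.mulVecLin_apply, Matrix.mulVecLin_apply, ← Matrix.mulVec_mulVec,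
      exchangeMatrix_mulVec, fromBlocks_one_mulVec, fromBlocks_one_mulVec, updateCol_mulVec,
      ← Matrix.mulVec_smul, ← Matrix.mulVec_add]
    congr 1
    · congr 1
      ext i
      by_cases h : i = j
      · subst h; simp [mul_comm]
      · simp [h]
    · ext k
      simp [k.2]
  · rintro _ ⟨w, rfl⟩
    refine ⟨Sum.elim (fun i => if h : i = j then w (Sum.inl j) else
      w (Sum.inr ⟨i, h⟩) - w (Sum.inl j) * v i)
      (fun k : {k // k ≠ j} => w (Sum.inl k.1)), ?_⟩
    rw [Matrix.mulVecLin_apply, Matrix.mulVecLin_apply, ← Matrix.mulVec_mulVec,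
      exchangeMatrix_mulVec, fromBlocks_one_mulVec, fromBlocks_one_mulVec, updateCol_mulVec,
      ← Matrix.mulVec_smul, ← Matrix.mulVec_add]
    congr 1
    congr 1
    ext i
    by_cases h : i = j
    · subst h; simp [mul_comm]
    · simp [h]

end ColumnExchange

/-! ### Exchanging all columns -/

section SteinitzExchange

variable {Γ : Type v} [AddCommGroup Γ] [DecidableEq Γ] {R : Type u} [CommRing R]
  {𝒜 : Γ → AddSubgroup R}

theorem range_updateCol_mulVec_le {ι κ : Type*} [Fintype κ] [DecidableEq κ] (A : Matrix ι κ R)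
    (j : κ) (v : κ → R) : LinearMap.range (A.updateCol j (A.mulVec v)).mulVecLin ≤
      LinearMap.range A.mulVecLin := by
  rintro _ ⟨c, rfl⟩
  refine ⟨Function.update c j 0 + c j • v, ?_⟩
  rw [Matrix.mulVecLin_apply, Matrix.mulVecLin_apply, updateCol_mulVec, Matrix.mulVec_add,
    Matrix.mulVec_smul]

theorem GrMod.exists_isPresentedBy [GradedRing 𝒜] {ι : Type*} [Fintype ι] {d e : ι → Γ}
    {A : Matrix ι ι R} (hA : HomogeneousEntries 𝒜 d e A) : ∃ M : GrMod 𝒜, M.IsPresentedBy d A := by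
  let f : ι ≃ Fin (Fintype.card ι) := Fintype.equivFin ι
  have h : IsHomogeneousMatrix 𝒜 (d ∘ f.symm) (e ∘ f.symm) (A.submatrix f.symm f.symm) :=
    fun j k => hA _ _
  refine ⟨GrMod.coker h, ?_⟩
  have h1 := (GrMod.coker_isPresentedBy h).reindex f f
  rw [Matrix.submatrix_submatrix] at h1
  have h2 : (d ∘ f.symm) ∘ f = d := by ext; simp
  have h3 : A.submatrix (f.symm ∘ f) (f.symm ∘ f) = A := by ext; simp
  rwa [h2, h3] at h1

variable {ι : Type*} [Fintype ι] [DecidableEq ι]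

theorem det_updateCol_mulVec (A : Matrix ι ι R) (j : ι) (v : ι → R) :
    (A.updateCol j (A.mulVec v)).det = A.det * v j := by
  rw [← Matrix.cramer_apply, Matrix.cramer_eq_adjugate_mulVec, Matrix.mulVec_mulVec,
    Matrix.adjugate_mul, Matrix.smul_mulVec, Matrix.one_mulVec, Pi.smul_apply, smul_eq_mul]

variable [GradedRing 𝒜]

/-- The `(i, j)` entry of the adjugate is the determinant of `A` with the `j`-th row replaced by a
standard basis vector; this matrix is homogeneous if the new row gets the degree `e i`. -/
theorem HomogeneousEntries.adjugate {d e : ι → Γ} {A : Matrix ι ι R}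
    (hA : HomogeneousEntries 𝒜 d e A) :
    HomogeneousEntries 𝒜 e (fun k => (∑ i, e i - ∑ i, d i) + d k) A.adjugate := by
  intro i j
  rw [Matrix.adjugate_apply]
  have h : HomogeneousEntries 𝒜 (Function.update d j (e i)) e (A.updateRow j (Pi.single i 1)) := by
    intro k l
    by_cases hk : k = j
    · subst hk
      rw [Function.update_self, Matrix.updateRow_self, Pi.single_apply]
      split_ifs with hl
      · rw [hl, sub_self]
        exact SetLike.GradedOne.one_mem
      · exact zero_mem _
    · rw [Function.update_of_ne hk, Matrix.updateRow_ne hk]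
      exact hA k l
  have h1 := h.det_mem
  rw [Finset.sum_update_of_mem (Finset.mem_univ j)] at h1
  have h2 : ∑ x, d x = d j + ∑ x ∈ Finset.univ \ {j}, d x := by
    rw [← Finset.sum_sdiff (Finset.subset_univ {j}), Finset.sum_singleton, add_comm]
  have h3 : ∑ i, e i - ∑ i, d i + d j - e i =
      ∑ i, e i - (e i + ∑ x ∈ Finset.univ \ {j}, d x) := by
    rw [h2]; abel
  rwa [h3]

theorem HomogeneousEntries.updateCol_mulVec {d e : ι → Γ} {A : Matrix ι ι R}
    (hA : HomogeneousEntries 𝒜 d e A) {v : ι → R} {ε : Γ} (hv : ∀ k, v k ∈ 𝒜 (ε - e k)) (j : ι) :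
    HomogeneousEntries 𝒜 d (Function.update e j ε) (A.updateCol j (A.mulVec v)) := by
  intro i k
  by_cases hk : k = j
  · subst hk
    rw [Function.update_self, Matrix.updateCol_self]
    refine AddSubgroup.sum_mem _ fun l _ => ?_
    have h := SetLike.GradedMul.mul_mem (hA i l) (hv l)
    have h1 : e l - d i + (ε - e l) = ε - d i := by abel
    rwa [h1] at h
  · rw [Function.update_of_ne hk, Matrix.updateCol_ne hk]
    exact hA i k

variable [IsDomain R] [IsNoetherianRing R] {m : Ideal R}

/-- Two cokernels of the same matrix are linked; the new column in `directlyLinked_updateCol` may be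
the old one. -/
theorem directlyLinked_of_isPresentedBy (hm : IsGradedLocal 𝒜 m) {d e : ι → Γ} {A : Matrix ι ι R}
    (hA : HomogeneousEntries 𝒜 d e A) (hdA : A.det ≠ 0) {M N : GrMod 𝒜}
    (hM : M.IsPresentedBy d A) (hN : N.IsPresentedBy d A) (hMn : Nontrivial M) :
    DirectlyLinked M N := by
  have hι : Nonempty ι := by
    by_contra h
    rw [not_nonempty_iff] at h
    obtain ⟨π, h1, -⟩ := hM
    have := h1.subsingleton
    exact not_subsingleton M this
  obtain ⟨j⟩ := hι
  have hv : ∀ k, (Pi.single j 1 : ι → R) k ∈ 𝒜 (e j - e k) := by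
    intro k
    rw [Pi.single_apply]
    split_ifs with h
    · rw [h, sub_self]
      exact SetLike.GradedOne.one_mem
    · exact zero_mem _
  have hcol : A.updateCol j (A.mulVec (Pi.single j 1)) = A := by
    rw [Matrix.mulVec_single_one]
    exact Matrix.updateCol_eq_self A j
  refine directlyLinked_updateCol hm hA hdA hv (j := j) (by simp) hM ?_ hMn
  rwa [hcol]

/-- Nonzero multiples of arbitrarily many columns of `B` can be put into the matrix `A`, as in the
Steinitz exchange lemma, without leaving the liaison class of the cokernel. A multiple `det A' • b`
of the next column `b` of `B` is the linear combination of the columns of `A'` with the coefficient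
vector `adj(A') b`. It replaces a column `j` of `A'` with nonzero coefficient that has a nonzero
entry in the corresponding row of `adj(B) * A'`; this entry vanishes for the columns of `A'` that
are multiples of other columns of `B`. -/
theorem exists_sameLiaisonClass_columns (hm : IsGradedLocal 𝒜 m) {d e e' : ι → Γ}
    {A B : Matrix ι ι R} (hA : HomogeneousEntries 𝒜 d e A) (hB : HomogeneousEntries 𝒜 d e' B)
    (hdA : A.det ≠ 0) (hdB : B.det ≠ 0) (I : Finset ι) :
    ∃ (e₁ : ι → Γ) (A₁ : Matrix ι ι R), HomogeneousEntries 𝒜 d e₁ A₁ ∧ A₁.det ≠ 0 ∧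
      LinearMap.range A₁.mulVecLin ≤ LinearMap.range A.mulVecLin ∧
      (∀ i ∈ I, ∃ (j : ι) (f : R) (γ : Γ), f ≠ 0 ∧ f ∈ 𝒜 γ ∧ ∀ l, A₁ l j = f * B l i) ∧
      ∀ M N : GrMod 𝒜, M.IsPresentedBy d A → N.IsPresentedBy d A₁ → Nontrivial M →
        SameLiaisonClass M N := by
  induction I using Finset.induction_on with
  | empty =>
    exact ⟨e, A, hA, hdA, le_rfl, by simp, fun M N hM hN hMn =>
      .rel _ _ (directlyLinked_of_isPresentedBy hm hA hdA hM hN hMn)⟩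
  | insert i₀ I hi₀ ih =>
    obtain ⟨e₁, A₁, hA₁, hdA₁, hle, hcols, hlink⟩ := ih
    let δ : Γ := ∑ i, e₁ i - ∑ i, d i
    let v : ι → R := fun k => (A₁.adjugate * B) k i₀
    have hB' : HomogeneousEntries 𝒜 (fun k => δ + d k) (fun k => δ + e' k) B := by
      intro j k
      have h := hB j k
      rwa [← add_sub_add_left_eq_sub _ _ δ] at h
    have hv : ∀ k, v k ∈ 𝒜 (δ + e' i₀ - e₁ k) := fun k => (hA₁.adjugate.mul hB') k i₀
    have hA₁v : A₁.mulVec v = fun l => A₁.det * B l i₀ := by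
      ext l
      change (A₁ * (A₁.adjugate * B)) l i₀ = _
      rw [← Matrix.mul_assoc, Matrix.mul_adjugate, Matrix.smul_mul, Matrix.one_mul,
        Matrix.smul_apply, smul_eq_mul]
    obtain ⟨j, -, hj⟩ : ∃ j ∈ Finset.univ, (B.adjugate * A₁) i₀ j * v j ≠ 0 := by
      refine Finset.exists_ne_zero_of_sum_ne_zero ?_
      change ((B.adjugate * A₁) * (A₁.adjugate * B)) i₀ i₀ ≠ 0
      have h : (B.adjugate * A₁) * (A₁.adjugate * B) = (A₁.det * B.det) • (1 : Matrix ι ι R) := by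
        rw [Matrix.mul_assoc, ← Matrix.mul_assoc A₁, Matrix.mul_adjugate, Matrix.smul_mul,
          Matrix.one_mul, Matrix.mul_smul, Matrix.adjugate_mul, smul_smul]
      rw [h, Matrix.smul_apply, Matrix.one_apply_eq, smul_eq_mul, mul_one]
      exact mul_ne_zero hdA₁ hdB
    have hvj : v j ≠ 0 := right_ne_zero_of_mul hj
    refine ⟨_, _, hA₁.updateCol_mulVec hv j, ?_, (range_updateCol_mulVec_le A₁ j v).trans hle,
      ?_, ?_⟩
    · rw [det_updateCol_mulVec]
      exact mul_ne_zero hdA₁ hvj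
    · intro i hi
      rcases Finset.mem_insert.1 hi with rfl | hi
      · refine ⟨j, A₁.det, _, hdA₁, hA₁.det_mem, fun l => ?_⟩
        rw [Matrix.updateCol_self, hA₁v]
      · obtain ⟨j', f, γ, hf, hfγ, hl⟩ := hcols i hi
        refine ⟨j', f, γ, hf, hfγ, fun l => ?_⟩
        have hne : j' ≠ j := by
          rintro rfl
          refine left_ne_zero_of_mul hj ?_
          have h1 : (B.adjugate * A₁) i₀ j' = f * (B.adjugate * B) i₀ i := by
            rw [Matrix.mul_apply, Matrix.mul_apply, Finset.mul_sum]
            exact Finset.sum_congr rfl fun l _ => by rw [hl]; ring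
          have h2 : i₀ ≠ i := by rintro rfl; exact hi₀ hi
          rw [h1, Matrix.adjugate_mul, Matrix.smul_apply, Matrix.one_apply_ne h2, smul_zero,
            mul_zero]
        rw [Matrix.updateCol_ne hne]
        exact hl l
    · intro M N hM hN hMn
      obtain ⟨L, hL⟩ := GrMod.exists_isPresentedBy hA₁
      have hLn : Nontrivial L := hM.nontrivial_of_le hL hle hMn
      exact (hlink M L hM hL hMn).trans _ _ _
        (.rel _ _ (directlyLinked_updateCol hm hA₁ hdA₁ hv hvj hL hN hLn))

/-- Multiplying the columns of a presentation matrix by nonzero homogeneous elements does not change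
the liaison class of the cokernel. -/
theorem sameLiaisonClass_mul_diagonal (hm : IsGradedLocal 𝒜 m) {d e : ι → Γ} {B : Matrix ι ι R}
    (hB : HomogeneousEntries 𝒜 d e B) (hdB : B.det ≠ 0) {f : ι → R} {γ : ι → Γ}
    (hf : ∀ i, f i ≠ 0) (hfγ : ∀ i, f i ∈ 𝒜 (γ i)) {M N : GrMod 𝒜} (hM : M.IsPresentedBy d B)
    (hN : N.IsPresentedBy d (B * Matrix.diagonal f)) (hMn : Nontrivial M) :
    SameLiaisonClass M N := by
  -- the columns in `I` are multiplied one after the other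
  suffices H : ∀ (I : Finset ι) (N : GrMod 𝒜),
      N.IsPresentedBy d (B * Matrix.diagonal fun i => if i ∈ I then f i else 1) →
        SameLiaisonClass M N by
    refine H Finset.univ N ?_
    simpa using hN
  intro I
  induction I using Finset.induction_on with
  | empty =>
    intro N hN
    refine .rel _ _ (directlyLinked_of_isPresentedBy hm hB hdB hM ?_ hMn)
    simpa using hN
  | insert i₀ I hi₀ ih =>
    intro N hN
    let g : ι → R := fun i => if i ∈ I then f i else 1
    have hC : HomogeneousEntries 𝒜 d (fun i => e i + if i ∈ I then γ i else 0)
        (B * Matrix.diagonal g) := by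
      intro j k
      rw [Matrix.mul_diagonal]
      have hg : g k ∈ 𝒜 (if k ∈ I then γ k else 0) := by
        change (if k ∈ I then f k else 1) ∈ _
        split_ifs
        · exact hfγ k
        · exact SetLike.GradedOne.one_mem
      rw [add_sub_right_comm]
      exact SetLike.GradedMul.mul_mem (hB j k) hg
    have hdC : (B * Matrix.diagonal g).det ≠ 0 := by
      rw [Matrix.det_mul, Matrix.det_diagonal]
      refine mul_ne_zero hdB (Finset.prod_ne_zero_iff.2 fun i _ => ?_)
      change (if i ∈ I then f i else 1) ≠ 0
      split_ifs
      · exact hf i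
      · exact one_ne_zero
    obtain ⟨L, hL⟩ := GrMod.exists_isPresentedBy hC
    have hLn : Nontrivial L := hM.nontrivial_of_le hL (by
      rintro _ ⟨v, rfl⟩
      exact ⟨(Matrix.diagonal g).mulVec v, by simp [Matrix.mulVec_mulVec]⟩) hMn
    refine (ih L hL).trans _ _ _ (.rel _ _ ?_)
    have hv : ∀ k, (Pi.single i₀ (f i₀) : ι → R) k ∈
        𝒜 ((γ i₀ + (e i₀ + if i₀ ∈ I then γ i₀ else 0)) - (e k + if k ∈ I then γ k else 0)) := by
      intro k
      by_cases hk : k = i₀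
      · rw [hk, Pi.single_eq_same, add_sub_cancel_right]
        exact hfγ _
      · rw [Pi.single_eq_of_ne hk]
        exact zero_mem _
    refine directlyLinked_updateCol hm hC hdC hv (j := i₀) (by simpa using hf i₀) hL ?_ hLn
    have hcol : (B * Matrix.diagonal g).updateCol i₀
        ((B * Matrix.diagonal g).mulVec (Pi.single i₀ (f i₀))) =
          B * Matrix.diagonal fun i => if i ∈ insert i₀ I then f i else 1 := by
      ext j k
      rw [Matrix.mul_diagonal]
      by_cases hk : k = i₀
      · subst hk
        simp [g, hi₀, mul_comm]
      · rw [Matrix.updateCol_ne hk, Matrix.mul_diagonal]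
        simp [g, hk]
    rwa [hcol]

/-- All nonzero cokernels of square matrices of the same size with nonzero determinant and with the
same row degrees are in the same liaison class. -/
theorem sameLiaisonClass_of_isPresentedBy (hm : IsGradedLocal 𝒜 m) {d e e' : ι → Γ}
    {A B : Matrix ι ι R} (hA : HomogeneousEntries 𝒜 d e A) (hB : HomogeneousEntries 𝒜 d e' B)
    (hdA : A.det ≠ 0) (hdB : B.det ≠ 0) {M N : GrMod 𝒜} (hM : M.IsPresentedBy d A)
    (hN : N.IsPresentedBy d B) (hMn : Nontrivial M) (hNn : Nontrivial N) :
    SameLiaisonClass M N := by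
  obtain ⟨e₁, A₁, hA₁, hdA₁, hle, hcols, hlink⟩ :=
    exists_sameLiaisonClass_columns hm hA hB hdA hdB Finset.univ
  choose j f γ hf hfγ hl using fun i => hcols i (Finset.mem_univ i)
  have hmul : ∀ i i', (B.adjugate * A₁) i (j i') = f i' * (B.adjugate * B) i i' := by
    intro i i'
    rw [Matrix.mul_apply, Matrix.mul_apply, Finset.mul_sum]
    exact Finset.sum_congr rfl fun l _ => by rw [hl]; ring
  have hj : Function.Injective j := by
    intro i i' hii
    by_contra hne
    have h1 := hmul i i
    rw [hii, hmul i i', Matrix.adjugate_mul, Matrix.smul_apply, Matrix.smul_apply,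
      Matrix.one_apply_ne hne, Matrix.one_apply_eq, smul_zero, mul_zero, smul_eq_mul,
      mul_one] at h1
    exact mul_ne_zero (hf i) hdB h1.symm
  let σ : ι ≃ ι := Equiv.ofBijective j (Finite.injective_iff_bijective.1 hj)
  have hσ : (B * Matrix.diagonal f).submatrix (Equiv.refl ι) σ.symm = A₁ := by
    ext l k
    obtain ⟨i, rfl⟩ := σ.surjective k
    rw [Matrix.submatrix_apply, Equiv.symm_apply_apply, Matrix.mul_diagonal]
    exact ((hl i l).trans (mul_comm _ _)).symm
  obtain ⟨L, hL⟩ := GrMod.exists_isPresentedBy (e := fun i => e' i + γ i)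
    (A := B * Matrix.diagonal f) (fun i k => by
      rw [Matrix.mul_diagonal, add_sub_right_comm]
      exact SetLike.GradedMul.mul_mem (hB i k) (hfγ k))
  have hL₁ : L.IsPresentedBy d A₁ := by
    have h := hL.reindex (Equiv.refl ι) σ.symm
    rwa [hσ] at h
  exact (hlink M L hM hL₁ hMn).trans _ _ _
    ((sameLiaisonClass_mul_diagonal hm hB hdB hf hfγ hN hL hNn).symm _ _)

end SteinitzExchange

/-! ### The liaison class of a cyclic module -/

section Principal

variable {Γ : Type v} [AddCommGroup Γ] [DecidableEq Γ] {R : Type u} [CommRing R]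
  {𝒜 : Γ → AddSubgroup R}

theorem GrMod.IsPresentedBy.nontrivial_of_not_isUnit_det {ι : Type*} [Fintype ι] [DecidableEq ι]
    {X : GrMod 𝒜} {d : ι → Γ} {A : Matrix ι ι R} (h : X.IsPresentedBy d A)
    (hA : ¬ IsUnit A.det) : Nontrivial X := by
  by_contra hX
  rw [not_nontrivial_iff_subsingleton] at hX
  refine hA (isUnit_of_dvd_one ?_)
  simpa using h.det_dvd_pow (r := 1) (Module.mem_annihilator.2 fun x => Subsingleton.elim _ _)

variable [GradedRing 𝒜]

theorem GrMod.isPresentedBy_of_cyclic {X : GrMod 𝒜} (p : GrHom (GrMod.self 𝒜) X)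
    (hp : Function.Surjective p.lin) {a : R} (ha : ∀ x : R, p.lin x = 0 ↔ a ∣ x) :
    X.IsPresentedBy (fun _ : Fin 1 => (0 : Γ)) (Matrix.of fun _ _ : Fin 1 => a) := by
  refine ⟨p.lin ∘ₗ LinearMap.proj 0, fun y => ?_, fun w => ?_, fun i w hw => ?_⟩
  · obtain ⟨x, rfl⟩ := hp y
    exact ⟨fun _ => x, rfl⟩
  · change p.lin (w 0) = 0 ↔ _
    rw [ha]
    constructor
    · rintro ⟨x, hx⟩
      refine ⟨fun _ => x, ?_⟩
      ext k
      rw [Subsingleton.elim k 0, hx]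
      simp [Matrix.mulVec, dotProduct]
    · rintro ⟨v, rfl⟩
      exact ⟨v 0, by simp [Matrix.mulVec, dotProduct]⟩
  · refine p.map_mem i _ ?_
    have h := hw 0
    rwa [sub_zero] at h

variable [IsDomain R] [IsNoetherianRing R] {m : Ideal R}

/-- The liaison class of a cyclic module `R/aR` consists of the perfect modules of codimension one.
The presentation matrices are bordered by identity matrices in order to have the same size and the
same row degrees. -/
theorem sameLiaisonClass_iff_isPerfectModule (hm : IsGradedLocal 𝒜 m) {X : GrMod 𝒜}
    (p : GrHom (GrMod.self 𝒜) X) (hp : Function.Surjective p.lin) {δ : Γ} {a : R} (ha : a ∈ 𝒜 δ)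
    (hpa : ∀ x : R, p.lin x = 0 ↔ a ∣ x) (ha0 : a ≠ 0) (hau : ¬ IsUnit a) (M : GrMod 𝒜) :
    SameLiaisonClass X M ↔ IsPerfectModule R M ∧ HasCodim R M 1 := by
  have hX := GrMod.isPresentedBy_of_cyclic p hp hpa
  have hE : HomogeneousEntries 𝒜 (fun _ : Fin 1 => (0 : Γ)) (fun _ : Fin 1 => δ)
      (Matrix.of fun _ _ : Fin 1 => a) := by
    intro j k
    rw [sub_zero]
    exact ha
  have hdet : (Matrix.of fun _ _ : Fin 1 => a).det = a := by simp
  have hXn : Nontrivial X := hX.nontrivial_of_not_isUnit_det (by rwa [hdet])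
  have hd0 : (Matrix.of fun _ _ : Fin 1 => a).det ≠ 0 := by rwa [hdet]
  constructor
  · intro h
    exact (h.isPerfectModule_iff hm.dim_ne_top).1 (hX.isPerfectModule hm hE hd0 hXn)
  · intro h
    obtain ⟨hMn, hM⟩ := (isPerfectModule_iff_hasSquarePresentation hm M).1 h
    obtain ⟨n, d, e, A, hA, hdA, hM⟩ := hM.exists_isPresentedBy
    have hM' := hM.fromBlocks_one (κ := Fin 1) fun _ => 0
    have hX' := (hX.fromBlocks_one d).reindex (Equiv.sumComm (Fin n) (Fin 1))
      (Equiv.sumComm (Fin n) (Fin 1))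
    have hd : (Sum.elim (fun _ : Fin 1 => (0 : Γ)) d) ∘ Equiv.sumComm (Fin n) (Fin 1) =
        Sum.elim d fun _ => 0 := by
      ext (i | i) <;> rfl
    rw [hd] at hX'
    have hE' : HomogeneousEntries 𝒜 (Sum.elim d fun _ : Fin 1 => (0 : Γ)) _ _ := fun j k => by
      have h := hE.fromBlocks_one d (Equiv.sumComm (Fin n) (Fin 1) j)
        (Equiv.sumComm (Fin n) (Fin 1) k)
      rwa [← Function.comp_apply (f := Sum.elim _ _) (x := j), hd,
        ← Matrix.submatrix_apply (Matrix.fromBlocks _ _ _ _)] at h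
    refine sameLiaisonClass_of_isPresentedBy hm hE' (hA.fromBlocks_one fun _ => 0) ?_ ?_ hX' hM'
      hXn hMn
    · rw [Matrix.det_submatrix_equiv_self, Matrix.det_fromBlocks_zero₂₁, Matrix.det_one, mul_one]
      exact hd0
    · rwa [Matrix.det_fromBlocks_zero₂₁, Matrix.det_one, mul_one]

end Principal

theorem mainTheorem2 (R : Type u) [CommRing R] [IsDomain R] [IsGorensteinRing R] :
    -- the graded case
    (∀ (K : Type v) [Field K] [Algebra K R] (𝒜 : ℤ → AddSubgroup R) [GradedRing 𝒜],
      IsStandardGraded K 𝒜 →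
      ∀ (δ : ℤ) (a : R) (ha : a ∈ 𝒜 δ), a ≠ 0 → ¬ IsUnit a →
      ∀ M : GrMod 𝒜,
        (SameLiaisonClass (GrMod.modPrincipal ha) M ↔ IsPerfectModule R M ∧ HasCodim R M 1) ∧
        (IsPerfectModule R M ∧ HasCodim R M 1 ↔ Nontrivial M ∧ HasSquarePresentation M)) ∧
    -- the local case
    (∀ [IsLocalRing R] (a : R), a ≠ 0 → ¬ IsUnit a →
      ∀ (M : Type u) [AddCommGroup M] [Module R M] [Module.Finite R M],
        (SameLiaisonClass (GrMod.ofModule R (R ⧸ Ideal.span {a})) (GrMod.ofModule R M) ↔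
          IsPerfectModule R M ∧ HasCodim R M 1) ∧
        (IsPerfectModule R M ∧ HasCodim R M 1 ↔
          Nontrivial M ∧ HasSquarePresentation (GrMod.ofModule R M))) := by
  constructor
  · intro K _ _ 𝒜 _ hstd δ a ha ha0 hau M
    have hm := hstd.isGradedLocal
    refine ⟨?_, isPerfectModule_iff_hasSquarePresentation hm M⟩
    let p : GrHom (GrMod.self 𝒜) (GrMod.modPrincipal ha) :=
      ⟨(LinearMap.range (mulHom ha).lin).mkQ, fun i x hx => ⟨x, hx, rfl⟩⟩
    refine sameLiaisonClass_iff_isPerfectModule hm p (Submodule.mkQ_surjective _) ha ?_ ha0 hau M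
    intro x
    change (LinearMap.range (mulHom ha).lin).mkQ x = 0 ↔ _
    rw [Submodule.mkQ_apply, Submodule.Quotient.mk_eq_zero]
    exact ⟨fun ⟨y, hy⟩ => ⟨y, hy.symm.trans (mul_comm _ _)⟩,
      fun ⟨y, hy⟩ => ⟨y, (mul_comm _ _).trans hy.symm⟩⟩
  · intro _ a ha0 hau M _ _ _
    have hm := isGradedLocal_trivialGrading R
    refine ⟨?_, isPerfectModule_iff_hasSquarePresentation hm (GrMod.ofModule R M)⟩
    let p : GrHom (GrMod.self (trivialGrading R)) (GrMod.ofModule R (R ⧸ Ideal.span {a})) :=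
      ⟨(Ideal.span {a}).mkQ, fun _ _ _ => trivial⟩
    refine sameLiaisonClass_iff_isPerfectModule hm p (Submodule.mkQ_surjective _) (δ := ())
      trivial ?_ ha0 hau _
    intro x
    change (Ideal.span {a}).mkQ x = 0 ↔ _
    rw [Submodule.mkQ_apply, Submodule.Quotient.mk_eq_zero, Ideal.mem_span_singleton]
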